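/- Let $d\ge 3$, and let $V$ be a real symmetric positive definite $d\times d$ matrix with $V_{aa}=1$ for all $a$; let $\lambda$ be its smallest eigenvalue. Let $\kappa>0$ and $\gamma\in(0,1]$, and let $h:\mathbb{R}^d\to\mathbb{R}$ be a $(\kappa,\gamma,V)$-Lipschitz function, i.e. a Borel function such that $$E\big((h(Y)-h(Y'))^2\big)\le \kappa^2\,\big(E\|Y-Y'\|^2\big)^{\gamma}$$ for every centered Gaussian vector $(Y,Y')$ in $\mathbb{R}^d\times\mathbb{R}^d$ with $\operatorname{cov}(Y)\le V$ and $\operatorname{cov}(Y')\le V$ (that is, $V-\operatorname{cov}(Y)$ and $V-\operatorname{cov}(Y')$ are positive semi-definite); here $\|\cdot\|$ is the Euclidean norm. Let $(i_n)_{n\ge0}$ be independent random variables uniformly distributed over $\{1,\dots,d\}$, and let $(g_n)_{n\ge0}$ be independent standard Gaussian random variables, the sequence $(g_n)$ being independent of the sequence $(i_n)$. Let $X_0=0$ and $$X_{n+1}=X_n+(g_n-e_{i_n}^TX_n)\,(Ve_{i_n}),\qquad n\ge0,$$ where $e_a$ is the $a$-th standard basis vector of $\mathbb{R}^d$. For $X\sim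 N(0,V)$ set $m=E(h(X))$, $\Sigma^2=\operatorname{var}(h(X))$ with $\Sigma\ge0$, and let $\kappa'=2\kappa d^{1+\gamma}/(\lambda\gamma)$. Then $h(X)$ is square-integrable. Moreover, for every even $n>0$, the estimator $\frac{2}{n}\sum_{j=n/2}^{n-1}h(X_j)$ is square-integrable and $$\Big|E\Big(\frac{\sum_{j=n/2}^{n-1}h(X_j)}{n/2}-m\Big)\Big|\le 2\kappa'\,\frac{e^{-\lambda\gamma n/(4d)}}{n}.$$ Furthermore, if $\Sigma>0$, $\delta=\lceil 4(\lambda\gamma)^{-1}d\ln(\kappa d/\Sigma)\rceil$ and $n>2\delta$, then $$E\Big(\Big(\frac{\sum_{j=n/2}^{n-1}h(X_j)}{n/2}-m\Big)^2\Big)\le 34\,\frac{\delta\,\Sigma^2}{n}.$$ -/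

import Mathlib

open MeasureTheory ProbabilityTheory
open scoped ENNReal

noncomputable section

/-- The covariance matrix `E (Y Yᵀ)` of a centered random vector `Y` in `ℝ^d`, defined on a
measure space `(Ω, μ)`. -/
def covMatrix {Ω : Type*} [MeasurableSpace Ω] {d : ℕ} (μ : Measure Ω)
    (Y : Ω → EuclideanSpace ℝ (Fin d)) : Matrix (Fin d) (Fin d) ℝ :=
  Matrix.of fun a b => ∫ ω, Y ω a * Y ω b ∂μ

/-- `(κ, γ, W)`-Lipschitz functions: Borel functions `h` on `ℝ^d` such that
`E (h(X) - h(X'))² ≤ κ² (E ‖X - X'‖²)^γ` for every centered Gaussian vector `(X, X')` with values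
in `ℝ^d × ℝ^d` such that `cov X ≤ W` and `cov X' ≤ W` in the Loewner order.
The Gaussian vector is represented by its law `ν`. The left-hand side is an integral with values
in `[0, ∞]`, so that the inequality includes its finiteness. -/
structure IsGaussianLipschitz {d : ℕ} (κ γ : ℝ) (W : Matrix (Fin d) (Fin d) ℝ)
    (h : EuclideanSpace ℝ (Fin d) → ℝ) : Prop where
  measurable : Measurable h
  bound : ∀ ν : Measure (EuclideanSpace ℝ (Fin d) × EuclideanSpace ℝ (Fin d)),
    IsGaussian ν → ∫ p, p ∂ν = 0 →
    (W - covMatrix ν Prod.fst).PosSemidef → (W - covMatrix ν Prod.snd).PosSemidef →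
    ∫⁻ p, ENNReal.ofReal ((h p.1 - h p.2) ^ 2) ∂ν ≤
      ENNReal.ofReal (κ ^ 2 * (∫ p, ‖p.1 - p.2‖ ^ 2 ∂ν) ^ γ)

/-- The mean `m = E h(X)`, where `X ∼ N(0, V)`. -/
def gaussianMean {d : ℕ} (V : Matrix (Fin d) (Fin d) ℝ) (h : EuclideanSpace ℝ (Fin d) → ℝ) : ℝ :=
  ∫ x, h x ∂(multivariateGaussian 0 V)

/-- The standard deviation `Σ` of `h(X)`, where `X ∼ N(0, V)`. -/
def gaussianStd {d : ℕ} (V : Matrix (Fin d) (Fin d) ℝ) (h : EuclideanSpace ℝ (Fin d) → ℝ) : ℝ :=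
  Real.sqrt (Var[h; multivariateGaussian 0 V])

/-- The chain `X_0 = 0`, `X_{n+1} = X_n + (g_n - e_{i_n}ᵀ X_n) (V e_{i_n})`, driven by a sequence
of indices `i` and a sequence of real numbers `g`. -/
def chain {d : ℕ} (V : Matrix (Fin d) (Fin d) ℝ) (i : ℕ → Fin d) (g : ℕ → ℝ) :
    ℕ → EuclideanSpace ℝ (Fin d)
  | 0 => 0
  | n + 1 => chain V i g n +
      (g n - chain V i g n (i n)) • WithLp.toLp 2 (V.mulVec (Pi.single (i n) 1))

/-- The estimator `(∑_{j = n/2}^{n-1} h(X_j)) / (n/2)`, for even `n > 0`. -/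
def burnInEstimator {d : ℕ} (V : Matrix (Fin d) (Fin d) ℝ) (h : EuclideanSpace ℝ (Fin d) → ℝ)
    (n : ℕ) (i : ℕ → Fin d) (g : ℕ → ℝ) : ℝ :=
  (∑ j ∈ Finset.Ico (n / 2) n, h (chain V i g j)) / ((n : ℝ) / 2)

/-- The random inputs of the chain: the `i_n` are independent and uniformly distributed over the
`d` indices, the `g_n` are independent standard Gaussian random variables, and the sequence
`(g_n)` is independent of the sequence `(i_n)`. -/
structure IsChainInput {Ω : Type*} [MeasurableSpace Ω] {d : ℕ} (P : Measure Ω)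
    (i : ℕ → Ω → Fin d) (g : ℕ → Ω → ℝ) : Prop where
  measurable_index : ∀ n, Measurable (i n)
  measurable_noise : ∀ n, Measurable (g n)
  law_index : ∀ n, P.map (i n) = uniformOn Set.univ
  law_noise : ∀ n, P.map (g n) = gaussianReal 0 1
  iIndepFun_index : iIndepFun i P
  iIndepFun_noise : iIndepFun g P
  indepFun : IndepFun (fun ω n => g n ω) (fun ω n => i n ω) P

end

/-! One step with index `a` is the affine map `y ↦ M_a y + g V e_a` with `M_a = I - V e_a e_aᵀ`.
Since `V_aa = 1`, `M_a V M_aᵀ + V e_a e_aᵀ V = V`, so `N(0, V)` is invariant for every choice of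
indices. The proof compares the chain with a stationary copy, started from `N(0, V)` and driven by
the same inputs: the difference of the two is the product of the `M_a` applied to the initial
vector.

Contraction. In the norm `yᵀ V⁻¹ y`, the map `M_a` is an orthogonal projection and removes exactly
`y_a ^ 2`. Averaging over `a` removes `‖y‖² / d ≥ (λ / d) yᵀ V⁻¹ y`, so after `m` steps the mean of
the form is at most `(1 - λ/d) ^ m` times its initial value. That value has mean `d` under `N(0,
V)`, and `‖y‖² ≤ d yᵀ V⁻¹ y`, whence a mean squared distance of at most `d² (1 - λ/d) ^ m`
(`lintegral_norm_transition_le`).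

Lipschitz property. The chain is Gaussian only conditionally on the indices, so the indices are
frozen, the hypothesis on `h` is applied, and Jensen's inequality for `x ↦ x ^ γ` averages over the
indices. With `K = κ d ^ γ` and `r = (1 - λ/d) ^ (γ/2)`, the values of `h` on the stationary chain
at time `j + m` and on the chain restarted from `0` at time `j` are within `K r ^ m` in `L²`
(`lintegral_coupling_le`). Taking `j = 0` gives the bias. Given the indices, the restarted chain is
independent of the stationary chain at time `j`, so the stationary covariance at lag `m` is at most
`Σ K r ^ m` (`abs_integral_mul_centered_le`).

Averaging. Geometric sums and `1 - r ≥ λγ / (2d)` give the bias bound. For the squared error, `δ` is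
large enough that `K r ^ δ / (1 - r) ≤ Σ δ` (`mixing_time_bound`): lags below `δ` are bounded by
`Σ²`, the others by the geometric tail (`integral_sq_average_le`). -/

abbrev Eucl (d : ℕ) := EuclideanSpace ℝ (Fin d)

/-! ### Affine dynamics of the chain -/

/-- The `a`-th column `V e_a` of `V`. -/
def column {d : ℕ} (V : Matrix (Fin d) (Fin d) ℝ) (a : Fin d) : Eucl d :=
  WithLp.toLp 2 (V.mulVec (Pi.single a 1))

@[simp]
lemma column_apply {d : ℕ} (V : Matrix (Fin d) (Fin d) ℝ) (a b : Fin d) :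
    column V a b = V b a := by
  simp [column]

/-- The linear part `y ↦ y - y_a V e_a` of a step of the chain. -/
noncomputable def stepMap {d : ℕ} (V : Matrix (Fin d) (Fin d) ℝ) (a : Fin d) :
    Eucl d →L[ℝ] Eucl d :=
  ContinuousLinearMap.id ℝ _ - (EuclideanSpace.proj a).smulRight (column V a)

lemma stepMap_apply {d : ℕ} (V : Matrix (Fin d) (Fin d) ℝ) (a : Fin d) (y : Eucl d) :
    stepMap V a y = y - y a • column V a := by
  simp [stepMap]

/-- The linear part of the first `n` steps of the chain with indices `i`. -/
noncomputable def transition {d : ℕ} (V : Matrix (Fin d) (Fin d) ℝ) (i : ℕ → Fin d) :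
    ℕ → Eucl d →L[ℝ] Eucl d
  | 0 => ContinuousLinearMap.id ℝ _
  | n + 1 => (stepMap V (i n)).comp (transition V i n)

lemma transition_succ_apply {d : ℕ} (V : Matrix (Fin d) (Fin d) ℝ) (i : ℕ → Fin d) (n : ℕ)
    (y : Eucl d) : transition V i (n + 1) y = stepMap V (i n) (transition V i n y) := rfl

lemma transition_add {d : ℕ} (V : Matrix (Fin d) (Fin d) ℝ) (i : ℕ → Fin d) (j m : ℕ)
    (y : Eucl d) :
    transition V i (j + m) y = transition V (fun k => i (j + k)) m (transition V i j y) := by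
  induction m with
  | zero => rfl
  | succ m ih => rw [← add_assoc, transition_succ_apply, ih, transition_succ_apply]

lemma chain_succ {d : ℕ} (V : Matrix (Fin d) (Fin d) ℝ) (i : ℕ → Fin d) (g : ℕ → ℝ) (n : ℕ) :
    chain V i g (n + 1) = stepMap V (i n) (chain V i g n) + g n • column V (i n) := by
  rw [stepMap_apply, chain, column]
  module

/-- Each step is affine, so the state at time `j` enters only through the linear part of the later
steps; what remains is a chain restarted from `0` on the later inputs. -/
lemma chain_add {d : ℕ} (V : Matrix (Fin d) (Fin d) ℝ) (i : ℕ → Fin d) (g : ℕ → ℝ) (j m : ℕ) :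
    chain V i g (j + m) = transition V (fun k => i (j + k)) m (chain V i g j) +
      chain V (fun k => i (j + k)) (fun k => g (j + k)) m := by
  induction m with
  | zero => simp [transition, chain]
  | succ m ih =>
    rw [← add_assoc, chain_succ, ih, transition_succ_apply, chain_succ, map_add, add_assoc]

/-- The chain with indices `i` and noise `g`, started at `x`. -/
noncomputable def chainFrom {d : ℕ} (V : Matrix (Fin d) (Fin d) ℝ) (i : ℕ → Fin d) (g : ℕ → ℝ)
    (x : Eucl d) (n : ℕ) : Eucl d :=
  transition V i n x + chain V i g n

lemma chainFrom_succ {d : ℕ} (V : Matrix (Fin d) (Fin d) ℝ) (i : ℕ → Fin d) (g : ℕ → ℝ)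
    (x : Eucl d) (n : ℕ) :
    chainFrom V i g x (n + 1) =
      stepMap V (i n) (chainFrom V i g x n) + g n • column V (i n) := by
  simp only [chainFrom, chain_succ, transition_succ_apply, map_add, add_assoc]

lemma chainFrom_add {d : ℕ} (V : Matrix (Fin d) (Fin d) ℝ) (i : ℕ → Fin d) (g : ℕ → ℝ)
    (x : Eucl d) (j m : ℕ) :
    chainFrom V i g x (j + m) = chainFrom V (fun k => i (j + k)) (fun k => g (j + k))
      (chainFrom V i g x j) m := by
  simp only [chainFrom, chain_add, transition_add, map_add, add_assoc]

lemma chain_congr {d : ℕ} (V : Matrix (Fin d) (Fin d) ℝ) (i : ℕ → Fin d) {g g' : ℕ → ℝ} {n : ℕ}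
    (hg : ∀ k < n, g k = g' k) : chain V i g n = chain V i g' n := by
  induction n with
  | zero => rfl
  | succ n ih => rw [chain_succ, chain_succ, ih fun k hk => hg k (by omega), hg n (by omega)]

lemma transition_congr {d : ℕ} (V : Matrix (Fin d) (Fin d) ℝ) {i i' : ℕ → Fin d} {n : ℕ}
    (hi : ∀ k < n, i k = i' k) : transition V i n = transition V i' n := by
  induction n with
  | zero => rfl
  | succ n ih => rw [transition, transition, ih fun k hk => hi k (by omega), hi n (by omega)]

/-! ### The quadratic form of `V⁻¹` -/

/-- The quadratic form `y ↦ yᵀ V⁻¹ y`. -/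
noncomputable def invForm {d : ℕ} (V : Matrix (Fin d) (Fin d) ℝ) (y : Eucl d) : ℝ :=
  y.ofLp ⬝ᵥ V⁻¹.mulVec y.ofLp

lemma Matrix.PosDef.inv_mulVec_column {d : ℕ} {V : Matrix (Fin d) (Fin d) ℝ} (hV : V.PosDef)
    (a : Fin d) : V⁻¹.mulVec (column V a).ofLp = Pi.single a 1 := by
  have := hV.isUnit
  rw [column, Matrix.mulVec_mulVec,
    Matrix.nonsing_inv_mul _ ((Matrix.isUnit_iff_isUnit_det _).1 this), Matrix.one_mulVec]

lemma Matrix.PosDef.inv_isSymm {d : ℕ} {V : Matrix (Fin d) (Fin d) ℝ} (hV : V.PosDef) :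
    V⁻¹.IsSymm := by
  have := hV.inv.isHermitian
  rw [Matrix.IsSymm, ← Matrix.conjTranspose_eq_transpose_of_trivial]
  exact this

lemma dotProduct_mulVec_comm_of_isSymm {ι : Type*} [Fintype ι] {A : Matrix ι ι ℝ} (hA : A.IsSymm)
    (x y : ι → ℝ) : x ⬝ᵥ A.mulVec y = y ⬝ᵥ A.mulVec x := by
  rw [Matrix.dotProduct_mulVec, ← Matrix.mulVec_transpose, hA.eq, dotProduct_comm]

lemma invForm_nonneg {d : ℕ} {V : Matrix (Fin d) (Fin d) ℝ} (hV : V.PosDef) (y : Eucl d) :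
    0 ≤ invForm V y := by
  simpa [invForm] using hV.inv.posSemidef.dotProduct_mulVec_nonneg y.ofLp

/-- For the inner product of `V⁻¹`, the column `V e_a` is a unit vector (as `V_aa = 1`) whose
product with `y` is `y_a`. The step is the projection along it, and the identity is Pythagoras. -/
lemma invForm_stepMap {d : ℕ} {V : Matrix (Fin d) (Fin d) ℝ} (hV : V.PosDef)
    (hVdiag : ∀ a, V a a = 1) (a : Fin d) (y : Eucl d) :
    invForm V (stepMap V a y) = invForm V y - y a ^ 2 := by
  have h1 : (column V a).ofLp ⬝ᵥ V⁻¹.mulVec y.ofLp = y a := by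
    rw [dotProduct_mulVec_comm_of_isSymm hV.inv_isSymm, hV.inv_mulVec_column]
    simp
  rw [invForm, invForm, stepMap_apply]
  simp only [WithLp.ofLp_sub, WithLp.ofLp_smul, Matrix.mulVec_sub, Matrix.mulVec_smul,
    hV.inv_mulVec_column, dotProduct_sub, sub_dotProduct, smul_dotProduct, dotProduct_smul, h1]
  simp [hVdiag]
  ring

lemma sq_apply_le_invForm {d : ℕ} {V : Matrix (Fin d) (Fin d) ℝ} (hV : V.PosDef)
    (hVdiag : ∀ a, V a a = 1) (a : Fin d) (y : Eucl d) : y a ^ 2 ≤ invForm V y := by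
  have := invForm_stepMap hV hVdiag a y
  linarith [invForm_nonneg hV (stepMap V a y)]

lemma norm_sq_le_invForm {d : ℕ} {V : Matrix (Fin d) (Fin d) ℝ} (hV : V.PosDef)
    (hVdiag : ∀ a, V a a = 1) (y : Eucl d) : ‖y‖ ^ 2 ≤ d * invForm V y := by
  rw [EuclideanSpace.real_norm_sq_eq]
  calc ∑ a, y a ^ 2 ≤ ∑ _a : Fin d, invForm V y :=
        Finset.sum_le_sum fun a _ => sq_apply_le_invForm hV hVdiag a y
    _ = d * invForm V y := by simp

/-! ### Least eigenvalue and one-step contraction -/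

section Eigenvalue

variable {d : ℕ} {V : Matrix (Fin d) (Fin d) ℝ} {lam : ℝ}

/-- Every eigenvalue of `V - λ I`, shifted by `λ`, is an eigenvalue of `V`, so it is nonnegative by
minimality of `λ`. -/
lemma leastEigenvalue_mul_le (hV : V.PosDef)
    (hlam : IsLeast {μ : ℝ | Module.End.HasEigenvalue (Matrix.toLin' V) μ} lam) (x : Fin d → ℝ) :
    lam * (x ⬝ᵥ x) ≤ x ⬝ᵥ V.mulVec x := by
  have key : (V - lam • (1 : Matrix (Fin d) (Fin d) ℝ)).PosSemidef := by
    have hH : (V - lam • (1 : Matrix (Fin d) (Fin d) ℝ)).IsHermitian :=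
      hV.isHermitian.sub (Matrix.isHermitian_one.smul (IsSelfAdjoint.all lam))
    rw [hH.posSemidef_iff_eigenvalues_nonneg]
    intro k
    have hk := hH.mulVec_eigenvectorBasis k
    rw [Matrix.sub_mulVec, Matrix.smul_mulVec, Matrix.one_mulVec, sub_eq_iff_eq_add,
      ← add_smul] at hk
    have hne : (hH.eigenvectorBasis k).ofLp ≠ 0 := by
      have := hH.eigenvectorBasis.orthonormal.ne_zero k
      simpa using this
    have := hlam.2 (show Module.End.HasEigenvalue (Matrix.toLin' V) (hH.eigenvalues k + lam) from
      Module.End.hasEigenvalue_of_hasEigenvector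
        ⟨Module.End.mem_eigenspace_iff.2 (by simpa using hk), hne⟩)
    simp only [Pi.zero_apply]
    linarith
  have := key.dotProduct_mulVec_nonneg x
  simp [Matrix.sub_mulVec, Matrix.smul_mulVec, dotProduct_sub] at this
  linarith

lemma leastEigenvalue_pos (hV : V.PosDef)
    (hlam : IsLeast {μ : ℝ | Module.End.HasEigenvalue (Matrix.toLin' V) μ} lam) : 0 < lam := by
  obtain ⟨x, hx⟩ := hlam.1.exists_hasEigenvector
  have h1 := hV.dotProduct_mulVec_pos hx.2
  have h2 : V.mulVec x = lam • x := by simpa using hx.apply_eq_smul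
  have h3 : 0 ≤ x ⬝ᵥ x := by simpa using dotProduct_star_self_nonneg x
  rw [h2] at h1
  simp at h1
  nlinarith

lemma leastEigenvalue_le_one (hV : V.PosDef) (hVdiag : ∀ a, V a a = 1)
    (hlam : IsLeast {μ : ℝ | Module.End.HasEigenvalue (Matrix.toLin' V) μ} lam) (a : Fin d) :
    lam ≤ 1 := by
  have := leastEigenvalue_mul_le hV hlam (Pi.single a 1)
  simpa [hVdiag] using this

/-- With `w = V⁻¹ y`, the form equals `⟨y, w⟩` and `λ ‖w‖² ≤ wᵀ V w = ⟨y, w⟩ ≤ ‖y‖ ‖w‖`. Hence `λ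
‖w‖ ≤ ‖y‖`, and Cauchy–Schwarz once more concludes. -/
lemma leastEigenvalue_mul_invForm_le (hV : V.PosDef)
    (hlam : IsLeast {μ : ℝ | Module.End.HasEigenvalue (Matrix.toLin' V) μ} lam) (y : Eucl d) :
    lam * invForm V y ≤ ‖y‖ ^ 2 := by
  have hpos := leastEigenvalue_pos hV hlam
  set w : Eucl d := WithLp.toLp 2 (V⁻¹.mulVec y.ofLp) with hw
  have hVw : V.mulVec w.ofLp = y.ofLp := by
    rw [hw, Matrix.mulVec_mulVec,
      Matrix.mul_nonsing_inv _ ((Matrix.isUnit_iff_isUnit_det _).1 hV.isUnit), Matrix.one_mulVec]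
  have hq : invForm V y = inner ℝ y w := by
    rw [EuclideanSpace.inner_eq_star_dotProduct, invForm]
    simp [hw, dotProduct_comm]
  have h1 : lam * ‖w‖ ^ 2 ≤ inner ℝ y w := by
    have := leastEigenvalue_mul_le hV hlam w.ofLp
    rw [hVw] at this
    rw [EuclideanSpace.inner_eq_star_dotProduct, EuclideanSpace.real_norm_sq_eq]
    simpa [dotProduct, pow_two] using this
  have h2 := real_inner_le_norm y w
  rw [hq]
  have h3 : lam * ‖w‖ ≤ ‖y‖ := by
    rcases (norm_nonneg w).eq_or_lt with h | h
    · rw [← h]; simp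
    · nlinarith
  nlinarith [norm_nonneg y]

lemma sum_invForm_stepMap_le (hV : V.PosDef) (hVdiag : ∀ a, V a a = 1)
    (hlam : IsLeast {μ : ℝ | Module.End.HasEigenvalue (Matrix.toLin' V) μ} lam) (y : Eucl d) :
    ∑ a, invForm V (stepMap V a y) ≤ (d - lam) * invForm V y := by
  simp only [invForm_stepMap hV hVdiag, Finset.sum_sub_distrib, ← EuclideanSpace.real_norm_sq_eq]
  have := leastEigenvalue_mul_invForm_le hV hlam y
  simp
  linarith

end Eigenvalue

/-! ### Joint measurability in indices, noise and starting point -/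

section Measurability

variable {d : ℕ} (V : Matrix (Fin d) (Fin d) ℝ)

lemma measurable_stepMap : Measurable fun p : Fin d × Eucl d => stepMap V p.1 p.2 :=
  measurable_from_prod_countable_right fun a => (stepMap V a).continuous.measurable

lemma measurable_transition (n : ℕ) :
    Measurable fun p : (ℕ → Fin d) × Eucl d => transition V p.1 n p.2 := by
  induction n with
  | zero => exact measurable_snd
  | succ n ih =>
    have h1 : Measurable fun p : (ℕ → Fin d) × Eucl d => (p.1 n, transition V p.1 n p.2) :=
      ((measurable_pi_apply n).comp measurable_fst).prodMk ih
    have h2 := (measurable_stepMap V).comp h1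
    simpa only [transition_succ_apply, Function.comp_def] using h2

lemma measurable_chain (n : ℕ) :
    Measurable fun p : (ℕ → Fin d) × (ℕ → ℝ) => chain V p.1 p.2 n := by
  induction n with
  | zero => exact measurable_const
  | succ n ih =>
    simp only [chain_succ]
    exact ((measurable_stepMap V).comp
      (((measurable_pi_apply n).comp measurable_fst).prodMk ih)).add
        (((measurable_pi_apply n).comp measurable_snd).smul
          ((measurable_of_countable (column V)).comp ((measurable_pi_apply n).comp measurable_fst)))

end Measurability

/-- By characteristic functions: tested against `u`, the linear part loses the variance `c ^ 2` with
`c = ⟨V e_a, u⟩`, and the fresh noise restores exactly this amount. -/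
lemma map_stepMap_multivariateGaussian {d : ℕ} {V : Matrix (Fin d) (Fin d) ℝ} (hV : V.PosSemidef)
    (hVdiag : ∀ a, V a a = 1) (a : Fin d) :
    ((multivariateGaussian 0 V).prod (gaussianReal 0 1)).map
      (fun p => stepMap V a p.1 + p.2 • column V a) = multivariateGaussian 0 V := by
  have hmeas : Measurable fun p : Eucl d × ℝ => stepMap V a p.1 + p.2 • column V a := by
    fun_prop
  apply Measure.ext_of_charFun
  ext u
  have hsymm : V.IsSymm := by
    rw [Matrix.IsSymm, ← Matrix.conjTranspose_eq_transpose_of_trivial]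
    exact hV.isHermitian
  set c : ℝ := inner ℝ (column V a) u with hc
  have hc' : V.mulVec u.ofLp a = c := by
    rw [hc, EuclideanSpace.inner_eq_star_dotProduct]
    simp only [star_trivial, dotProduct, Matrix.mulVec, column_apply]
    exact Finset.sum_congr rfl fun b _ => by rw [hsymm.apply, mul_comm]
  -- `w` is the adjoint of the step map applied to `u`.
  set w : Eucl d := u - c • EuclideanSpace.single a 1 with hw
  have hinner (y : Eucl d) (t : ℝ) :
      inner ℝ (stepMap V a y + t • column V a) u = inner ℝ y w + inner ℝ t c := by
    rw [stepMap_apply, hw, inner_add_left, inner_sub_left, inner_sub_right, inner_smul_left,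
      inner_smul_left, inner_smul_right, EuclideanSpace.inner_single_right, ← hc]
    simp
    ring
  have hquad : w.ofLp ⬝ᵥ V.mulVec w.ofLp = u.ofLp ⬝ᵥ V.mulVec u.ofLp - c ^ 2 := by
    have h1 : (Pi.single a (1 : ℝ) : Fin d → ℝ) ⬝ᵥ V.mulVec u.ofLp = c := by
      simp only [single_one_dotProduct, hc']
    have h2 : u.ofLp ⬝ᵥ V.mulVec (Pi.single a (1 : ℝ)) = c := by
      rw [dotProduct_mulVec_comm_of_isSymm hsymm, h1]
    have h3 : (Pi.single a (1 : ℝ) : Fin d → ℝ) ⬝ᵥ V.mulVec (Pi.single a 1) = 1 := by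
      simp [hVdiag]
    rw [hw]
    simp only [WithLp.ofLp_sub, WithLp.ofLp_smul, PiLp.ofLp_single, Matrix.mulVec_sub,
      Matrix.mulVec_smul, dotProduct_sub, sub_dotProduct, smul_dotProduct, dotProduct_smul, h1, h2,
      h3, smul_eq_mul]
    ring
  rw [charFun_apply, integral_map hmeas.aemeasurable (by fun_prop)]
  simp only [hinner, Complex.ofReal_add, add_mul, Complex.exp_add]
  rw [integral_prod_mul (fun y : Eucl d => Complex.exp ((inner ℝ y w : ℝ) * Complex.I))
    (fun t : ℝ => Complex.exp ((inner ℝ t c : ℝ) * Complex.I)), ← charFun_apply, ← charFun_apply,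
    charFun_multivariateGaussian hV, charFun_multivariateGaussian hV, charFun_gaussianReal, hquad,
    ← Complex.exp_add]
  congr 1
  simp
  ring

/-! ### The chain for deterministic indices -/

/-- A sequence of independent standard Gaussian random variables. -/
structure IsStdNoise {Ω : Type*} [MeasurableSpace Ω] (P : Measure Ω) (g : ℕ → Ω → ℝ) : Prop where
  measurable : ∀ n, Measurable (g n)
  law : ∀ n, P.map (g n) = gaussianReal 0 1
  indep : iIndepFun g P

lemma IsStdNoise.shift {Ω : Type*} [MeasurableSpace Ω] {P : Measure Ω} {g : ℕ → Ω → ℝ}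
    (hg : IsStdNoise P g) (j : ℕ) : IsStdNoise P fun k => g (j + k) where
  measurable _ := hg.measurable _
  law _ := hg.law _
  indep := hg.indep.precomp (add_right_injective j)

/-- The extension by zero of a finite family to a sequence. -/
noncomputable def extendZero (s : Finset ℕ) (t : s → ℝ) (k : ℕ) : ℝ :=
  if h : k ∈ s then t ⟨k, h⟩ else 0

lemma measurable_extendZero (s : Finset ℕ) : Measurable (extendZero s) := by
  refine measurable_pi_lambda _ fun k => ?_
  by_cases h : k ∈ s
  · simpa only [extendZero, h, dite_true] using measurable_pi_apply _
  · simpa only [extendZero, h, dite_false] using measurable_const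

section FixedIndices

variable {Ω : Type*} [MeasurableSpace Ω] {P : Measure Ω} [IsProbabilityMeasure P]
  {g : ℕ → Ω → ℝ} {d : ℕ} {V : Matrix (Fin d) (Fin d) ℝ}

omit [IsProbabilityMeasure P] in
lemma IsStdNoise.measurable_chain (hg : IsStdNoise P g) (i : ℕ → Fin d) (n : ℕ) :
    Measurable fun ω => chain V i (fun k => g k ω) n :=
  (_root_.measurable_chain V n).comp
    (measurable_const.prodMk (measurable_pi_lambda _ hg.measurable))

omit [IsProbabilityMeasure P] in
-- The two chains read disjoint blocks of the noise, `[0, j)` and `[j, j + m)`. Extending a block by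
-- zero is harmless, because a chain at time `n` depends only on its first `n` inputs.
lemma IsStdNoise.indepFun_chain (hg : IsStdNoise P g) (i i' : ℕ → Fin d) (j m : ℕ) :
    IndepFun (fun ω => chain V i (fun k => g k ω) j)
      (fun ω => chain V i' (fun k => g (j + k) ω) m) P := by
  have hdisj : Disjoint (Finset.range j) (Finset.Ico j (j + m)) := by
    rw [Finset.disjoint_left]
    intro k hk hk'
    simp at hk hk'
    omega
  have hm (s : Finset ℕ) : Measurable fun t : s → ℝ => extendZero s t := measurable_extendZero s
  have h1 : Measurable fun t : Finset.range j → ℝ => chain V i (extendZero (Finset.range j) t) j :=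
    (_root_.measurable_chain V j).comp (measurable_const.prodMk (hm _))
  have h2 : Measurable fun t : Finset.Ico j (j + m) → ℝ =>
      chain V i' (fun k => extendZero (Finset.Ico j (j + m)) t (j + k)) m :=
    (_root_.measurable_chain V m).comp (measurable_const.prodMk
      (measurable_pi_lambda _ fun k => (measurable_pi_apply (j + k)).comp (hm _)))
  have := (hg.indep.indepFun_finset _ _ hdisj hg.measurable).comp h1 h2
  convert this using 1
  · ext1 ω
    exact chain_congr V i fun k hk => by simp [extendZero, hk]
  · ext1 ω
    exact chain_congr V i' fun k hk => by simp [extendZero, hk]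

lemma map_prod_of_indepFun {α β γ δ : Type*} [MeasurableSpace α] [MeasurableSpace β]
    [MeasurableSpace γ] [MeasurableSpace δ] {N : Measure α} [IsProbabilityMeasure N]
    {U : Ω → β} {Z : Ω → γ} (hU : Measurable U) (hZ : Measurable Z) (hUZ : IndepFun U Z P)
    {φ : α × β → δ} (hφ : Measurable φ) :
    (N.prod P).map (fun p => (φ (p.1, U p.2), Z p.2)) =
      ((N.prod P).map fun p => φ (p.1, U p.2)).prod (P.map Z) := by
  have : IsProbabilityMeasure (P.map U) := Measure.isProbabilityMeasure_map hU.aemeasurable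
  have : IsProbabilityMeasure (P.map Z) := Measure.isProbabilityMeasure_map hZ.aemeasurable
  have hlaw := (indepFun_iff_map_prod_eq_prod_map_map hU.aemeasurable hZ.aemeasurable).1 hUZ
  have h1 : (N.prod P).map (fun p => φ (p.1, U p.2)) = (N.prod (P.map U)).map φ := by
    conv_rhs => rw [← Measure.map_id (μ := N)]
    rw [Measure.map_prod_map _ _ measurable_id hU, Measure.map_map hφ (by fun_prop)]
    rfl
  have h2 : (N.prod P).map (fun p => (p.1, (U p.2, Z p.2))) =
      N.prod ((P.map U).prod (P.map Z)) := by
    rw [← hlaw]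
    conv_rhs => rw [← Measure.map_id (μ := N)]
    rw [Measure.map_prod_map _ _ measurable_id (hU.prodMk hZ)]
    rfl
  have h3 : ((N.prod (P.map U)).map φ).prod (P.map Z) =
      ((N.prod (P.map U)).prod (P.map Z)).map (Prod.map φ id) := by
    rw [← Measure.map_prod_map _ _ hφ measurable_id, Measure.map_id]
  have h4 : (N.prod (P.map U)).prod (P.map Z) =
      (N.prod ((P.map U).prod (P.map Z))).map MeasurableEquiv.prodAssoc.symm := by
    rw [← Measure.prodAssoc_prod, MeasurableEquiv.map_symm_map]
  rw [h1, h3, h4, ← h2, Measure.map_map, Measure.map_map]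
  · rfl
  all_goals fun_prop

/-- The chain up to time `j`, with an independent random start, is independent of the chain
restarted from `0` at time `j`. This one fact serves the invariance of `N(0, V)`, the coupling bound
and the covariance bound. -/
lemma IsStdNoise.map_pair (hg : IsStdNoise P g) (i i' : ℕ → Fin d) (j m : ℕ)
    (N : Measure (Eucl d)) [IsProbabilityMeasure N] :
    (N.prod P).map (fun p => (chainFrom V i (fun k => g k p.2) p.1 j,
        chain V i' (fun k => g (j + k) p.2) m)) =
      ((N.prod P).map fun p => chainFrom V i (fun k => g k p.2) p.1 j).prod
        (P.map fun ω => chain V i' (fun k => g (j + k) ω) m) :=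
  map_prod_of_indepFun (φ := fun q : Eucl d × Eucl d => transition V i j q.1 + q.2)
    (hg.measurable_chain i j) ((hg.shift j).measurable_chain i' m) (hg.indepFun_chain i i' j m)
    (by fun_prop)

omit [IsProbabilityMeasure P] in
lemma IsStdNoise.map_noise_smul (hg : IsStdNoise P g) (i : ℕ → Fin d) (n : ℕ) :
    P.map (fun ω => chain V (fun k => i (n + k)) (fun k => g (n + k) ω) 1) =
      (gaussianReal 0 1).map (ContinuousLinearMap.toSpanSingleton ℝ (column V (i n))) := by
  rw [← hg.law n, Measure.map_map (by fun_prop) (hg.measurable n)]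
  congr 1
  ext1 ω
  rw [chain_succ]
  simp [chain]

lemma IsStdNoise.map_chainFrom (hg : IsStdNoise P g) (hV : V.PosSemidef)
    (hVdiag : ∀ a, V a a = 1) (i : ℕ → Fin d) (n : ℕ) :
    ((multivariateGaussian 0 V).prod P).map (fun p => chainFrom V i (fun k => g k p.2) p.1 n) =
      multivariateGaussian 0 V := by
  induction n with
  | zero =>
    simp only [chainFrom, transition, chain, add_zero]
    exact Measure.map_fst_prod.trans (by simp)
  | succ n ih =>
    have h1 : (fun p : Eucl d × Ω => chainFrom V i (fun k => g k p.2) p.1 (n + 1)) =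
        (fun q : Eucl d × Eucl d => stepMap V (i n) q.1 + q.2) ∘
          fun p => (chainFrom V i (fun k => g k p.2) p.1 n,
            chain V (fun k => i (n + k)) (fun k => g (n + k) p.2) 1) := by
      ext1 p
      rw [chainFrom_succ, Function.comp_apply, chain_succ]
      simp [chain]
    have hm1 : Measurable fun p : Eucl d × Ω => chainFrom V i (fun k => g k p.2) p.1 n :=
      ((transition V i n).continuous.measurable.comp measurable_fst).add
        ((hg.measurable_chain i n).comp measurable_snd)
    have hm2 : Measurable fun p : Eucl d × Ω =>
        chain V (fun k => i (n + k)) (fun k => g (n + k) p.2) 1 :=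
      ((hg.shift n).measurable_chain _ 1).comp measurable_snd
    rw [h1, ← Measure.map_map (by fun_prop) (hm1.prodMk hm2),
      hg.map_pair i (fun k => i (n + k)) n 1, ih, hg.map_noise_smul,
      ← Measure.map_id (μ := multivariateGaussian 0 V),
      Measure.map_prod_map _ _ measurable_id (by fun_prop),
      Measure.map_map (by fun_prop) (by fun_prop), Measure.map_id]
    exact map_stepMap_multivariateGaussian hV hVdiag (i n)

lemma IsStdNoise.isGaussian_map_chain (hg : IsStdNoise P g) (i : ℕ → Fin d) (n : ℕ) :
    IsGaussian (P.map fun ω => chain V i (fun k => g k ω) n) := by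
  induction n with
  | zero =>
    simp only [chain, Measure.map_const, measure_univ, one_smul]
    infer_instance
  | succ n ih =>
    have h1 : (fun ω => chain V i (fun k => g k ω) (n + 1)) =
        ((stepMap V (i n)).comp (ContinuousLinearMap.fst ℝ (Eucl d) (Eucl d)) +
          ContinuousLinearMap.snd ℝ (Eucl d) (Eucl d)) ∘
          fun ω => (chain V i (fun k => g k ω) n,
            chain V (fun k => i (n + k)) (fun k => g (n + k) ω) 1) := by
      ext1 ω
      rw [chain_succ, Function.comp_apply, chain_succ]
      simp [chain]
    have hm1 := hg.measurable_chain (V := V) i n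
    have hm2 := (hg.shift n).measurable_chain (V := V) (fun k => i (n + k)) 1
    rw [h1, ← Measure.map_map (by fun_prop) (hm1.prodMk hm2),
      (indepFun_iff_map_prod_eq_prod_map_map hm1.aemeasurable hm2.aemeasurable).1
        (hg.indepFun_chain i _ n 1), hg.map_noise_smul]
    infer_instance

end FixedIndices

/-! ### Covariances and the Lipschitz property for stationary couplings -/

section Covariance

variable {d : ℕ} {V : Matrix (Fin d) (Fin d) ℝ}

lemma IsGaussian.memLp_apply {E : Type*} [NormedAddCommGroup E] [NormedSpace ℝ E]
    [MeasurableSpace E] [BorelSpace E] (N : Measure E) [IsGaussian N] (L : E →L[ℝ] Eucl d)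
    (a : Fin d) : MemLp (fun y => L y a) 2 N :=
  IsGaussian.memLp_dual N ((EuclideanSpace.proj a).comp L) 2 (by simp)

lemma posSemidef_covMatrix {Ω : Type*} [MeasurableSpace Ω] {μ : Measure Ω} {Y : Ω → Eucl d}
    (hY : ∀ a, MemLp (fun ω => Y ω a) 2 μ) : (covMatrix μ Y).PosSemidef := by
  refine Matrix.PosSemidef.of_dotProduct_mulVec_nonneg ?_ fun t => ?_
  · ext a b
    simp [covMatrix, mul_comm]
  · have h1 : star t ⬝ᵥ (covMatrix μ Y).mulVec t = ∫ ω, (∑ a, t a * Y ω a) ^ 2 ∂μ := by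
      have hint (a b : Fin d) : Integrable (fun ω => t a * Y ω a * (t b * Y ω b)) μ := by
        have := ((hY a).integrable_mul (hY b)).const_mul (t a * t b)
        refine this.congr (.of_forall fun ω => ?_)
        simp
        ring
      simp only [pow_two, Finset.sum_mul_sum]
      rw [integral_finsetSum _ fun a _ => integrable_finsetSum _ fun b _ => hint a b]
      simp only [dotProduct, Matrix.mulVec, Finset.mul_sum, star_trivial]
      refine Finset.sum_congr rfl fun a _ => ?_
      rw [integral_finsetSum _ fun b _ => hint a b]
      refine Finset.sum_congr rfl fun b _ => ?_
      simp only [covMatrix, Matrix.of_apply]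
      rw [mul_comm (∫ ω, _ ∂μ), ← mul_assoc, ← integral_const_mul]
      congr 1
      ext1 ω
      ring
    rw [h1]
    exact integral_nonneg fun ω => sq_nonneg _

lemma covMatrix_multivariateGaussian (hV : V.PosSemidef) :
    covMatrix (multivariateGaussian 0 V) id = V := by
  ext a b
  have h0 (a : Fin d) : ∫ x : Eucl d, x a ∂(multivariateGaussian 0 V) = 0 := by
    have := IsGaussian.integral_dual (μ := multivariateGaussian 0 V) (EuclideanSpace.proj a)
    simpa using this
  have hm (a : Fin d) := IsGaussian.memLp_apply (multivariateGaussian 0 V)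
    (ContinuousLinearMap.id ℝ (Eucl d)) a
  have := covariance_eq_sub (hm a) (hm b)
  simp only [ContinuousLinearMap.id_apply, covariance_eval_multivariateGaussian hV, h0] at this
  rw [this]
  simp [covMatrix]

/-- If `M Y + Z` has the law of `Y`, where `Y ∼ N(0, V)` and `Z` are independent, then `Z` is
centered. -/
lemma integral_eq_zero_of_map_eq (M : Eucl d →L[ℝ] Eucl d) {ν : Measure (Eucl d)} [IsGaussian ν]
    (hν : ((multivariateGaussian 0 V).prod ν).map (fun p => M p.1 + p.2) =
      multivariateGaussian 0 V) : ∫ z, z ∂ν = 0 := by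
  have h1 : ∫ x, x ∂(((multivariateGaussian 0 V).prod ν).map fun p => M p.1 + p.2) = 0 := by
    rw [hν]; simp
  rw [integral_map (by fun_prop) (by fun_prop)] at h1
  have hi1 : Integrable (fun p : Eucl d × Eucl d => M p.1) ((multivariateGaussian 0 V).prod ν) :=
    (M.integrable_comp IsGaussian.integrable_id).comp_fst ν
  have hi2 : Integrable (fun p : Eucl d × Eucl d => p.2) ((multivariateGaussian 0 V).prod ν) :=
    IsGaussian.integrable_id.comp_snd (multivariateGaussian 0 V)
  rw [integral_add hi1 hi2, integral_fun_fst (fun y => M y), integral_fun_snd (fun z : Eucl d => z),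
    M.integral_comp_comm IsGaussian.integrable_fun_id] at h1
  simpa using h1

/-- If `M Y + Z` has the law of `Y`, where `Y ∼ N(0, V)` and `Z` are independent, then
`V - cov Z = cov (M Y)`. -/
lemma sub_covMatrix_eq_of_map_eq (hV : V.PosSemidef) (M : Eucl d →L[ℝ] Eucl d)
    {ν : Measure (Eucl d)} [IsGaussian ν]
    (hν : ((multivariateGaussian 0 V).prod ν).map (fun p => M p.1 + p.2) =
      multivariateGaussian 0 V) :
    V - covMatrix ν id = covMatrix (multivariateGaussian 0 V) M := by
  rw [sub_eq_iff_eq_add]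
  conv_lhs => rw [← covMatrix_multivariateGaussian hV]
  ext a b
  have h0 (a : Fin d) : ∫ z : Eucl d, z a ∂ν = 0 := by
    have := IsGaussian.integral_dual (μ := ν) (EuclideanSpace.proj a)
    rw [integral_eq_zero_of_map_eq M hν] at this
    simpa using this
  set N := multivariateGaussian 0 V with hN
  have hM (a : Fin d) := IsGaussian.memLp_apply N M a
  have hz (a : Fin d) := IsGaussian.memLp_apply ν (ContinuousLinearMap.id ℝ (Eucl d)) a
  have hi1 : Integrable (fun p : Eucl d × Eucl d => M p.1 a * M p.1 b) (N.prod ν) :=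
    Integrable.comp_fst ((hM a).integrable_mul (hM b)) ν
  have hi2 : Integrable (fun p : Eucl d × Eucl d => p.2 a * p.2 b) (N.prod ν) :=
    Integrable.comp_snd ((hz a).integrable_mul (hz b)) N
  have hi3 (a b : Fin d) : Integrable (fun p : Eucl d × Eucl d => M p.1 a * p.2 b) (N.prod ν) :=
    ((hM a).integrable (by simp)).mul_prod ((hz b).integrable (by simp))
  have h3 (a b : Fin d) : ∫ p : Eucl d × Eucl d, M p.1 a * p.2 b ∂(N.prod ν) = 0 := by
    rw [integral_prod_mul (fun y => M y a) (fun z : Eucl d => z b), h0, mul_zero]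
  have key : ∫ x : Eucl d, x a * x b ∂((N.prod ν).map fun p => M p.1 + p.2) =
      ∫ y, M y a * M y b ∂N + ∫ z : Eucl d, z a * z b ∂ν := by
    rw [integral_map (by fun_prop) (by fun_prop)]
    have hexp : (fun p : Eucl d × Eucl d => (M p.1 + p.2) a * (M p.1 + p.2) b) =
        fun p => (M p.1 a * M p.1 b + p.2 a * p.2 b) + (M p.1 a * p.2 b + M p.1 b * p.2 a) := by
      ext1 p
      simp
      ring
    rw [hexp]
    refine (integral_add (hi1.add hi2) ((hi3 a b).add (hi3 b a))).trans ?_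
    simp only [Pi.add_apply]
    rw [integral_add hi1 hi2,
      integral_add (hi3 a b) (hi3 b a), h3, h3,
      integral_fun_fst (fun y : Eucl d => M y a * M y b),
      integral_fun_snd (fun z : Eucl d => z a * z b)]
    simp
  rw [hν] at key
  simpa [covMatrix] using key

/-- The Lipschitz property applied to a coupling of a stationary vector `M Y + Z` with `Z`. -/
lemma IsGaussianLipschitz.lintegral_le {κ γ : ℝ} {h : Eucl d → ℝ}
    (hh : IsGaussianLipschitz κ γ V h) (hV : V.PosSemidef) (M : Eucl d →L[ℝ] Eucl d)
    {ν : Measure (Eucl d)} [IsGaussian ν]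
    (hν : ((multivariateGaussian 0 V).prod ν).map (fun p => M p.1 + p.2) =
      multivariateGaussian 0 V) :
    ∫⁻ p, ENNReal.ofReal ((h (M p.1 + p.2) - h p.2) ^ 2) ∂((multivariateGaussian 0 V).prod ν) ≤
      ENNReal.ofReal (κ ^ 2 * (∫ y, ‖M y‖ ^ 2 ∂(multivariateGaussian 0 V)) ^ γ) := by
  set N := multivariateGaussian 0 V with hN
  -- The pair `(M Y + Z, Z)` is a linear image of a product of Gaussian laws, hence jointly
  -- Gaussian.
  let L : (Eucl d × Eucl d) →L[ℝ] (Eucl d × Eucl d) :=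
    (M.comp (ContinuousLinearMap.fst ℝ _ _) + ContinuousLinearMap.snd ℝ _ _).prod
      (ContinuousLinearMap.snd ℝ _ _)
  have hL (p : Eucl d × Eucl d) : L p = (M p.1 + p.2, p.2) := rfl
  have hfst : (((N.prod ν).map L).map Prod.fst) = N := by
    rw [Measure.map_map (by fun_prop) (by fun_prop)]
    exact hν
  have hsnd : (((N.prod ν).map L).map Prod.snd) = ν := by
    rw [Measure.map_map (by fun_prop) (by fun_prop)]
    exact Measure.map_snd_prod.trans (by simp)
  have hcov (f : Eucl d × Eucl d → Eucl d) (hf : Measurable f) :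
      covMatrix ((N.prod ν).map L) f = covMatrix (((N.prod ν).map L).map f) id := by
    ext a b
    simp only [covMatrix, Matrix.of_apply]
    rw [integral_map hf.aemeasurable (by fun_prop)]
    rfl
  have hmean : ∫ p, p ∂((N.prod ν).map L) = 0 := by
    have hint : Integrable (fun p => p) ((N.prod ν).map L) := IsGaussian.integrable_id
    have h1 : ∫ p : Eucl d × Eucl d, p.1 ∂((N.prod ν).map L) = 0 := by
      rw [← integral_map (f := fun x : Eucl d => x) (by fun_prop) (by fun_prop), hfst]
      simp [hN]
    have h2 : ∫ p : Eucl d × Eucl d, p.2 ∂((N.prod ν).map L) = 0 := by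
      rw [← integral_map (f := fun x : Eucl d => x) (by fun_prop) (by fun_prop), hsnd]
      exact integral_eq_zero_of_map_eq M hν
    ext1
    · rw [fst_integral hint, h1]; rfl
    · rw [snd_integral hint, h2]; rfl
  -- The two Loewner conditions: `V - cov (M Y + Z) = 0` by stationarity, and `V - cov Z = cov (M
  -- Y)` is positive semidefinite.
  have := hh.bound ((N.prod ν).map L) inferInstance hmean
    (by
      rw [hcov _ measurable_fst, hfst, covMatrix_multivariateGaussian hV, sub_self]
      exact Matrix.PosSemidef.zero)
    (by
      rw [hcov _ measurable_snd, hsnd, sub_covMatrix_eq_of_map_eq hV M hν]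
      exact posSemidef_covMatrix fun a => IsGaussian.memLp_apply _ M a)
  have hm := hh.measurable
  rw [lintegral_map (by fun_prop) (by fun_prop), integral_map (by fun_prop) (by fun_prop)] at this
  simp only [hL, add_sub_cancel_right] at this
  rwa [integral_fun_fst (fun y : Eucl d => ‖M y‖ ^ 2), probReal_univ, one_smul] at this

end Covariance

/-! ### Random indices and Jensen's inequality -/

/-- A sequence of independent indices with the uniform distribution. -/
structure IsUniformIndices {Ω : Type*} [MeasurableSpace Ω] {d : ℕ} (P : Measure Ω)
    (i : ℕ → Ω → Fin d) : Prop where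
  measurable : ∀ n, Measurable (i n)
  law : ∀ n, P.map (i n) = uniformOn Set.univ
  indep : iIndepFun i P

lemma IsUniformIndices.shift {Ω : Type*} [MeasurableSpace Ω] {d : ℕ} {P : Measure Ω}
    {i : ℕ → Ω → Fin d} (hi : IsUniformIndices P i) (j : ℕ) :
    IsUniformIndices P fun k => i (j + k) where
  measurable _ := hi.measurable _
  law _ := hi.law _
  indep := hi.indep.precomp (add_right_injective j)

lemma lintegral_uniformOn_univ {d : ℕ} (f : Fin d → ℝ≥0∞) :
    ∫⁻ a, f a ∂(uniformOn Set.univ) = (d : ℝ≥0∞)⁻¹ * ∑ a, f a := by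
  rw [uniformOn, ProbabilityTheory.cond, lintegral_smul_measure, Measure.restrict_univ,
    lintegral_count, tsum_fintype]
  simp

/-- Jensen's inequality for the concave power `γ ≤ 1`, read off from the monotonicity of `L^p` norms
on a probability space between the exponents `γ` and `1`. -/
lemma lintegral_rpow_le {Ω : Type*} [MeasurableSpace Ω] {P : Measure Ω} [IsProbabilityMeasure P]
    {F : Ω → ℝ≥0∞} (hF : AEMeasurable F P) {γ : ℝ} (hγ0 : 0 < γ) (hγ1 : γ ≤ 1) :
    ∫⁻ ω, F ω ^ γ ∂P ≤ (∫⁻ ω, F ω ∂P) ^ γ := by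
  have := eLpNorm'_le_eLpNorm'_of_exponent_le hγ0 hγ1 P hF.aestronglyMeasurable
  simp only [eLpNorm', enorm_eq_self, ENNReal.rpow_one, div_one] at this
  calc ∫⁻ ω, F ω ^ γ ∂P = ((∫⁻ ω, F ω ^ γ ∂P) ^ (1 / γ)) ^ γ := by
        rw [← ENNReal.rpow_mul, one_div_mul_cancel hγ0.ne', ENNReal.rpow_one]
    _ ≤ _ := ENNReal.rpow_le_rpow this hγ0.le

/-! ### Geometric contraction on average -/

section Contraction

variable {Ω : Type*} [MeasurableSpace Ω] {P : Measure Ω} [IsProbabilityMeasure P]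
  {d : ℕ} {V : Matrix (Fin d) (Fin d) ℝ} {lam : ℝ} {i : ℕ → Ω → Fin d}

omit [IsProbabilityMeasure P] in
lemma IsUniformIndices.measurable_transition (hi : IsUniformIndices P i) (m : ℕ) (y : Eucl d) :
    Measurable fun ω => transition V (fun k => i k ω) m y :=
  (_root_.measurable_transition V m).comp
    ((measurable_pi_lambda _ hi.measurable).prodMk measurable_const)

omit [IsProbabilityMeasure P] in
lemma IsUniformIndices.indepFun_transition (hd : 0 < d) (hi : IsUniformIndices P i) (m : ℕ)
    (y : Eucl d) :
    IndepFun (fun ω => transition V (fun k => i k ω) m y) (i m) P := by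
  have hdisj : Disjoint (Finset.range m) {m} := by simp
  -- The indices outside the first `m` are filled with an arbitrary value; `transition` does not
  -- read them.
  let e (t : Finset.range m → Fin d) (k : ℕ) : Fin d :=
    if h : k ∈ Finset.range m then t ⟨k, h⟩ else ⟨0, hd⟩
  have he : Measurable e := by
    refine measurable_pi_lambda _ fun k => ?_
    by_cases h : k ∈ Finset.range m
    · simpa only [e, h, dite_true] using measurable_pi_apply _
    · simpa only [e, h, dite_false] using measurable_const
  have h1 : Measurable fun t : Finset.range m → Fin d => transition V (e t) m y :=
    (_root_.measurable_transition V m).comp (he.prodMk measurable_const)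
  have h2 : Measurable fun t : ({m} : Finset ℕ) → Fin d => t ⟨m, by simp⟩ := measurable_pi_apply _
  have := (hi.indep.indepFun_finset _ _ hdisj hi.measurable).comp h1 h2
  have heq (ω : Ω) : transition V (fun k => i k ω) m =
      transition V (e fun k => i k ω) m :=
    transition_congr V fun k hk => by simp [e, hk]
  simp only [heq]
  exact this

lemma measurable_invForm : Measurable (invForm V) := by
  unfold invForm
  simp only [dotProduct, Matrix.mulVec]
  fun_prop

/-- The index `i m` is independent of the first `m` steps, so it can be averaged first: each step
costs a factor `1 - λ / d`. -/
lemma IsUniformIndices.lintegral_invForm_le (hd : 0 < d) (hi : IsUniformIndices P i)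
    (hV : V.PosDef) (hVdiag : ∀ a, V a a = 1)
    (hlam : IsLeast {μ : ℝ | Module.End.HasEigenvalue (Matrix.toLin' V) μ} lam) (m : ℕ)
    (y : Eucl d) :
    ∫⁻ ω, ENNReal.ofReal (invForm V (transition V (fun k => i k ω) m y)) ∂P ≤
      ENNReal.ofReal ((1 - lam / d) ^ m) * ENNReal.ofReal (invForm V y) := by
  have hd' : (1 : ℝ) ≤ d := by exact_mod_cast hd
  have hlam1 := leastEigenvalue_le_one hV hVdiag hlam ⟨0, hd⟩
  have hs : 0 ≤ 1 - lam / d := by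
    rw [sub_nonneg, div_le_one (by linarith)]
    linarith
  have hmq : Measurable (invForm V) := measurable_invForm
  induction m with
  | zero => simp [transition]
  | succ m ih =>
    have hstep (z : Eucl d) : ∫⁻ a, ENNReal.ofReal (invForm V (stepMap V a z))
        ∂(uniformOn Set.univ) ≤ ENNReal.ofReal (1 - lam / d) * ENNReal.ofReal (invForm V z) := by
      rw [lintegral_uniformOn_univ, ← ENNReal.ofReal_sum_of_nonneg fun a _ => invForm_nonneg hV _,
        ← ENNReal.ofReal_natCast, ← ENNReal.ofReal_inv_of_pos (by linarith),
        ← ENNReal.ofReal_mul (by positivity), ← ENNReal.ofReal_mul hs]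
      refine ENNReal.ofReal_le_ofReal ?_
      rw [inv_mul_le_iff₀ (by linarith)]
      refine (sum_invForm_stepMap_le hV hVdiag hlam z).trans_eq ?_
      field_simp
    have hT := hi.measurable_transition (V := V) m y
    have hlaw := (indepFun_iff_map_prod_eq_prod_map_map hT.aemeasurable
      (hi.measurable m).aemeasurable).1 (hi.indepFun_transition hd m y)
    have hF : Measurable fun p : Eucl d × Fin d =>
        ENNReal.ofReal (invForm V (stepMap V p.2 p.1)) :=
      (hmq.comp ((measurable_stepMap V).comp measurable_swap)).ennreal_ofReal
    have : IsProbabilityMeasure (P.map (i m)) :=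
      Measure.isProbabilityMeasure_map (hi.measurable m).aemeasurable
    calc ∫⁻ ω, ENNReal.ofReal (invForm V (transition V (fun k => i k ω) (m + 1) y)) ∂P
        = ∫⁻ p, ENNReal.ofReal (invForm V (stepMap V p.2 p.1))
            ∂(P.map fun ω => (transition V (fun k => i k ω) m y, i m ω)) := by
          rw [lintegral_map hF (hT.prodMk (hi.measurable m))]
          rfl
      _ = ∫⁻ ω, ∫⁻ a, ENNReal.ofReal (invForm V
            (stepMap V a (transition V (fun k => i k ω) m y))) ∂(P.map (i m)) ∂P := by
          rw [hlaw, lintegral_prod _ hF.aemeasurable,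
            lintegral_map hF.lintegral_prod_right' hT]
      _ ≤ ∫⁻ ω, ENNReal.ofReal (1 - lam / d) *
            ENNReal.ofReal (invForm V (transition V (fun k => i k ω) m y)) ∂P := by
          rw [hi.law]
          exact lintegral_mono fun ω => hstep _
      _ ≤ _ := by
          rw [lintegral_const_mul _ (hmq.fun_comp hT).ennreal_ofReal, pow_succ',
            ENNReal.ofReal_mul hs, mul_assoc]
          gcongr

/-- The mean of `yᵀ V⁻¹ y` is the trace of `V⁻¹ V`. -/
lemma lintegral_invForm_multivariateGaussian (hV : V.PosDef) :
    ∫⁻ y, ENNReal.ofReal (invForm V y) ∂(multivariateGaussian 0 V) = d := by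
  have hm (a : Fin d) := IsGaussian.memLp_apply (multivariateGaussian 0 V)
    (ContinuousLinearMap.id ℝ (Eucl d)) a
  have hq (y : Eucl d) : invForm V y = ∑ a, ∑ b, V⁻¹ a b * (y a * y b) := by
    simp only [invForm, dotProduct, Matrix.mulVec, Finset.mul_sum]
    refine Finset.sum_congr rfl fun a _ => Finset.sum_congr rfl fun b _ => by ring
  have hint (a b : Fin d) : Integrable (fun y : Eucl d => V⁻¹ a b * (y a * y b))
      (multivariateGaussian 0 V) := ((hm a).integrable_mul (hm b)).const_mul _
  have hcov (a b : Fin d) : ∫ y : Eucl d, y a * y b ∂(multivariateGaussian 0 V) = V a b :=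
    congrFun₂ (covMatrix_multivariateGaussian hV.posSemidef) a b
  have hint' : Integrable (invForm V) (multivariateGaussian 0 V) := by
    rw [funext hq]
    exact integrable_finsetSum _ fun a _ => integrable_finsetSum _ fun b _ => hint a b
  rw [← ofReal_integral_eq_lintegral_ofReal hint' (.of_forall fun y => invForm_nonneg hV y),
    ← ENNReal.ofReal_natCast]
  congr 1
  simp only [hq]
  rw [integral_finsetSum _ fun a _ => integrable_finsetSum _ fun b _ => hint a b]
  have hsymm : V.IsSymm := by
    rw [Matrix.IsSymm, ← Matrix.conjTranspose_eq_transpose_of_trivial]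
    exact hV.isHermitian
  have htr : (V⁻¹ * V).trace = d := by
    rw [Matrix.nonsing_inv_mul _ ((Matrix.isUnit_iff_isUnit_det _).1 hV.isUnit)]
    simp
  rw [← htr, Matrix.trace]
  refine Finset.sum_congr rfl fun a _ => ?_
  rw [integral_finsetSum _ fun b _ => hint a b, Matrix.diag_apply, Matrix.mul_apply]
  refine Finset.sum_congr rfl fun b _ => ?_
  rw [integral_const_mul, hcov, hsymm.apply]

/-- One factor `d` comes from `‖y‖² ≤ d yᵀ V⁻¹ y`, the other from the mean of the form under `N(0,
V)`. -/
lemma IsUniformIndices.lintegral_norm_transition_le (hd : 0 < d) (hi : IsUniformIndices P i)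
    (hV : V.PosDef) (hVdiag : ∀ a, V a a = 1)
    (hlam : IsLeast {μ : ℝ | Module.End.HasEigenvalue (Matrix.toLin' V) μ} lam) (m : ℕ) :
    ∫⁻ ω, ∫⁻ y, ENNReal.ofReal (‖transition V (fun k => i k ω) m y‖ ^ 2)
        ∂(multivariateGaussian 0 V) ∂P ≤ ENNReal.ofReal ((d : ℝ) ^ 2 * (1 - lam / d) ^ m) := by
  have hjoint : Measurable fun p : Ω × Eucl d => transition V (fun k => i k p.1) m p.2 :=
    (_root_.measurable_transition V m).comp
      (((measurable_pi_lambda _ hi.measurable).comp measurable_fst).prodMk measurable_snd)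
  have hmeas : Measurable fun p : Ω × Eucl d =>
      ENNReal.ofReal (‖transition V (fun k => i k p.1) m p.2‖ ^ 2) := by fun_prop
  have hmq : Measurable (invForm V) := measurable_invForm
  rw [lintegral_lintegral_swap hmeas.aemeasurable]
  calc ∫⁻ y, ∫⁻ ω, ENNReal.ofReal (‖transition V (fun k => i k ω) m y‖ ^ 2) ∂P
        ∂(multivariateGaussian 0 V)
      ≤ ∫⁻ y, ∫⁻ ω, d * ENNReal.ofReal (invForm V (transition V (fun k => i k ω) m y)) ∂P
        ∂(multivariateGaussian 0 V) := by
        refine lintegral_mono fun y => lintegral_mono fun ω => ?_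
        rw [← ENNReal.ofReal_natCast, ← ENNReal.ofReal_mul (by positivity)]
        exact ENNReal.ofReal_le_ofReal (norm_sq_le_invForm hV hVdiag _)
    _ ≤ ∫⁻ y, d * (ENNReal.ofReal ((1 - lam / d) ^ m) * ENNReal.ofReal (invForm V y))
        ∂(multivariateGaussian 0 V) := by
        refine lintegral_mono fun y => ?_
        have hT := hi.measurable_transition (V := V) m y
        rw [lintegral_const_mul _ (hmq.fun_comp hT).ennreal_ofReal]
        gcongr
        exact hi.lintegral_invForm_le hd hV hVdiag hlam m y
    _ = ENNReal.ofReal ((d : ℝ) ^ 2 * (1 - lam / d) ^ m) := by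
        rw [lintegral_const_mul _ (hmq.ennreal_ofReal.const_mul _),
          lintegral_const_mul _ hmq.ennreal_ofReal, lintegral_invForm_multivariateGaussian hV,
          ENNReal.ofReal_mul (by positivity), pow_two, ENNReal.ofReal_mul (by positivity),
          ENNReal.ofReal_natCast]
        ring

lemma IsUniformIndices.lintegral_rpow_norm_transition_le (hd : 0 < d)
    (hi : IsUniformIndices P i) (hV : V.PosDef) (hVdiag : ∀ a, V a a = 1)
    (hlam : IsLeast {μ : ℝ | Module.End.HasEigenvalue (Matrix.toLin' V) μ} lam) {γ : ℝ}
    (hγ0 : 0 < γ) (hγ1 : γ ≤ 1) (m : ℕ) :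
    ∫⁻ ω, ENNReal.ofReal ((∫ y, ‖transition V (fun k => i k ω) m y‖ ^ 2
        ∂(multivariateGaussian 0 V)) ^ γ) ∂P ≤
      ENNReal.ofReal (((d : ℝ) ^ 2 * (1 - lam / d) ^ m) ^ γ) := by
  have hjoint : Measurable fun p : Ω × Eucl d => transition V (fun k => i k p.1) m p.2 :=
    (_root_.measurable_transition V m).comp
      (((measurable_pi_lambda _ hi.measurable).comp measurable_fst).prodMk measurable_snd)
  have hmeas : Measurable fun p : Ω × Eucl d =>
      ENNReal.ofReal (‖transition V (fun k => i k p.1) m p.2‖ ^ 2) := by fun_prop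
  have hlam1 := leastEigenvalue_le_one hV hVdiag hlam ⟨0, hd⟩
  have hs : 0 ≤ 1 - lam / d := by
    have : (1 : ℝ) ≤ d := by exact_mod_cast hd
    rw [sub_nonneg, div_le_one (by linarith)]
    linarith
  have heq (ω : Ω) : ENNReal.ofReal ((∫ y, ‖transition V (fun k => i k ω) m y‖ ^ 2
      ∂(multivariateGaussian 0 V)) ^ γ) = (∫⁻ y, ENNReal.ofReal
        (‖transition V (fun k => i k ω) m y‖ ^ 2) ∂(multivariateGaussian 0 V)) ^ γ := by
    have hint : Integrable (fun y => ‖transition V (fun k => i k ω) m y‖ ^ 2)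
        (multivariateGaussian 0 V) :=
      ((transition V (fun k => i k ω) m).comp_memLp' IsGaussian.memLp_two_id).integrable_norm_pow
        (by simp)
    rw [← ENNReal.ofReal_rpow_of_nonneg (integral_nonneg fun y => by positivity) hγ0.le,
      ofReal_integral_eq_lintegral_ofReal hint (.of_forall fun y => by positivity)]
  simp only [heq]
  refine (lintegral_rpow_le hmeas.lintegral_prod_right'.aemeasurable hγ0 hγ1).trans ?_
  rw [← ENNReal.ofReal_rpow_of_nonneg (by positivity) hγ0.le]
  exact ENNReal.rpow_le_rpow (hi.lintegral_norm_transition_le hd hV hVdiag hlam m) hγ0.le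

end Contraction

/-! ### Conditioning on the index sequence -/

section Freezing

variable {Ω : Type*} [MeasurableSpace Ω] {P : Measure Ω} [IsProbabilityMeasure P]
  {d : ℕ} {i : ℕ → Ω → Fin d} {g : ℕ → Ω → ℝ} {N : Measure (Eucl d)} [IsProbabilityMeasure N]

lemma map_prod_freeze (hi : ∀ n, Measurable (i n)) (hg : ∀ n, Measurable (g n))
    (hind : IndepFun (fun ω n => g n ω) (fun ω n => i n ω) P) :
    (N.prod P).map (fun p => ((p.1, fun n => g n p.2), fun n => i n p.2)) =
      ((N.prod P).map fun p => (p.1, fun n => g n p.2)).prod (P.map fun ω n => i n ω) :=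
  map_prod_of_indepFun (φ := fun q : Eucl d × (ℕ → ℝ) => q) (measurable_pi_lambda _ hg)
    (measurable_pi_lambda _ hi) hind measurable_id

/-- Noise and starting point are jointly independent of the indices, so Tonelli allows integrating
over them with the indices held fixed, where the chain is Gaussian. -/
lemma lintegral_freeze (hi : ∀ n, Measurable (i n)) (hg : ∀ n, Measurable (g n))
    (hind : IndepFun (fun ω n => g n ω) (fun ω n => i n ω) P)
    {F : (Eucl d × (ℕ → ℝ)) × (ℕ → Fin d) → ℝ≥0∞} (hF : Measurable F) :
    ∫⁻ p, F ((p.1, fun n => g n p.2), fun n => i n p.2) ∂(N.prod P) =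
      ∫⁻ ω, ∫⁻ p, F ((p.1, fun n => g n p.2), fun n => i n ω) ∂(N.prod P) ∂P := by
  have hi' : Measurable fun ω n => i n ω := measurable_pi_lambda _ hi
  have hg' : Measurable fun p : Eucl d × Ω => (p.1, fun n => g n p.2) :=
    measurable_fst.prodMk (measurable_pi_lambda _ fun n => (hg n).comp measurable_snd)
  have h1 : Measurable fun p : Eucl d × Ω => ((p.1, fun n => g n p.2), fun n => i n p.2) :=
    hg'.prodMk (hi'.comp measurable_snd)
  have : IsProbabilityMeasure ((N.prod P).map fun p => (p.1, fun n => g n p.2)) :=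
    Measure.isProbabilityMeasure_map hg'.aemeasurable
  have : IsProbabilityMeasure (P.map fun ω n => i n ω) :=
    Measure.isProbabilityMeasure_map hi'.aemeasurable
  rw [← lintegral_map hF h1, map_prod_freeze hi hg hind, lintegral_prod_symm _ hF.aemeasurable,
    lintegral_map hF.lintegral_prod_left' hi']
  refine lintegral_congr fun ω => ?_
  rw [lintegral_map (hF.fun_comp measurable_prodMk_right) hg']

lemma integral_freeze_eq_zero (hi : ∀ n, Measurable (i n)) (hg : ∀ n, Measurable (g n))
    (hind : IndepFun (fun ω n => g n ω) (fun ω n => i n ω) P)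
    {F : (Eucl d × (ℕ → ℝ)) × (ℕ → Fin d) → ℝ} (hF : Measurable F)
    (hint : Integrable (fun p => F ((p.1, fun n => g n p.2), fun n => i n p.2)) (N.prod P))
    (h0 : ∀ a, ∫ p, F ((p.1, fun n => g n p.2), a) ∂(N.prod P) = 0) :
    ∫ p, F ((p.1, fun n => g n p.2), fun n => i n p.2) ∂(N.prod P) = 0 := by
  have hi' : Measurable fun ω n => i n ω := measurable_pi_lambda _ hi
  have hg' : Measurable fun p : Eucl d × Ω => (p.1, fun n => g n p.2) :=
    measurable_fst.prodMk (measurable_pi_lambda _ fun n => (hg n).comp measurable_snd)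
  have h1 : Measurable fun p : Eucl d × Ω => ((p.1, fun n => g n p.2), fun n => i n p.2) :=
    hg'.prodMk (hi'.comp measurable_snd)
  have : IsProbabilityMeasure ((N.prod P).map fun p => (p.1, fun n => g n p.2)) :=
    Measure.isProbabilityMeasure_map hg'.aemeasurable
  have : IsProbabilityMeasure (P.map fun ω n => i n ω) :=
    Measure.isProbabilityMeasure_map hi'.aemeasurable
  have hint' := (integrable_map_measure hF.aestronglyMeasurable h1.aemeasurable).2 hint
  rw [← integral_map h1.aemeasurable hF.aestronglyMeasurable]
  rw [map_prod_freeze hi hg hind] at hint' ⊢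
  rw [integral_prod_symm _ hint']
  refine integral_eq_zero_of_ae (.of_forall fun a => ?_)
  exact (integral_map hg'.aemeasurable
    (hF.fun_comp measurable_prodMk_right).aestronglyMeasurable).trans (h0 a)

end Freezing

/-! ### Coupling the stationary chain with a restarted chain -/

section Coupling

variable {Ω : Type*} [MeasurableSpace Ω] {P : Measure Ω} [IsProbabilityMeasure P]
  {d : ℕ} {V : Matrix (Fin d) (Fin d) ℝ} {lam κ γ : ℝ} {h : Eucl d → ℝ}
  {i : ℕ → Ω → Fin d} {g : ℕ → Ω → ℝ}

variable (V) in
lemma measurable_chainFrom (n : ℕ) :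
    Measurable fun q : (Eucl d × (ℕ → ℝ)) × (ℕ → Fin d) => chainFrom V q.2 q.1.2 q.1.1 n := by
  have h1 := (measurable_transition V n).comp
    (measurable_snd.prodMk (measurable_fst.comp measurable_fst) :
      Measurable fun q : (Eucl d × (ℕ → ℝ)) × (ℕ → Fin d) => (q.2, q.1.1))
  have h2 := (measurable_chain V n).comp
    (measurable_snd.prodMk (measurable_snd.comp measurable_fst) :
      Measurable fun q : (Eucl d × (ℕ → ℝ)) × (ℕ → Fin d) => (q.2, q.1.2))
  exact h1.add h2

variable (V) in
lemma measurable_chain_shift (j n : ℕ) :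
    Measurable fun q : (Eucl d × (ℕ → ℝ)) × (ℕ → Fin d) =>
      chain V (fun k => q.2 (j + k)) (fun k => q.1.2 (j + k)) n := by
  have h1 : Measurable fun q : (Eucl d × (ℕ → ℝ)) × (ℕ → Fin d) => fun k => q.2 (j + k) :=
    measurable_pi_lambda _ fun k => (measurable_pi_apply _).comp measurable_snd
  have h2 : Measurable fun q : (Eucl d × (ℕ → ℝ)) × (ℕ → Fin d) => fun k => q.1.2 (j + k) :=
    measurable_pi_lambda _ fun k =>
      (measurable_pi_apply _).comp (measurable_snd.comp measurable_fst)
  exact (measurable_chain V n).comp (h1.prodMk h2)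

/-- The chain driven by `i` and `g` and started at the first coordinate, as a random vector on
`ℝ^d × Ω`. -/
noncomputable def stationaryChain (V : Matrix (Fin d) (Fin d) ℝ) (i : ℕ → Ω → Fin d)
    (g : ℕ → Ω → ℝ) (j : ℕ) (p : Eucl d × Ω) : Eucl d :=
  chainFrom V (fun k => i k p.2) (fun k => g k p.2) p.1 j

/-- The chain restarted from `0` at time `j`, after `m` more steps. -/
noncomputable def restartedChain (V : Matrix (Fin d) (Fin d) ℝ) (i : ℕ → Ω → Fin d)
    (g : ℕ → Ω → ℝ) (j m : ℕ) (p : Eucl d × Ω) : Eucl d :=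
  chain V (fun k => i (j + k) p.2) (fun k => g (j + k) p.2) m

lemma measurable_noise_index (hi : ∀ n, Measurable (i n)) (hg : ∀ n, Measurable (g n)) :
    Measurable fun p : Eucl d × Ω => ((p.1, fun n => g n p.2), fun n => i n p.2) :=
  (measurable_fst.prodMk (measurable_pi_lambda _ fun n => (hg n).comp measurable_snd)).prodMk
    (measurable_pi_lambda _ fun n => (hi n).comp measurable_snd)

variable (V) in
lemma measurable_stationaryChain (hi : ∀ n, Measurable (i n)) (hg : ∀ n, Measurable (g n))
    (j : ℕ) : Measurable (stationaryChain V i g j) :=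
  (measurable_chainFrom V j).comp (measurable_noise_index hi hg)

variable (V) in
lemma measurable_restartedChain (hi : ∀ n, Measurable (i n)) (hg : ∀ n, Measurable (g n))
    (j m : ℕ) : Measurable (restartedChain V i g j m) :=
  (measurable_chain_shift V j m).comp (measurable_noise_index hi hg)

lemma map_stationaryChain (hi : IsUniformIndices P i) (hg : IsStdNoise P g)
    (hind : IndepFun (fun ω n => g n ω) (fun ω n => i n ω) P) (hV : V.PosSemidef)
    (hVdiag : ∀ a, V a a = 1) (j : ℕ) :
    ((multivariateGaussian 0 V).prod P).map (stationaryChain V i g j) =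
      multivariateGaussian 0 V := by
  refine Measure.ext_of_lintegral _ fun F hF => ?_
  rw [lintegral_map hF (measurable_stationaryChain V hi.measurable hg.measurable j)]
  have hm := measurable_chainFrom V j
  refine (lintegral_freeze hi.measurable hg.measurable hind (hF.comp hm)).trans ?_
  have h1 (ω : Ω) : ∫⁻ p, (F ∘ fun q : (Eucl d × (ℕ → ℝ)) × (ℕ → Fin d) =>
      chainFrom V q.2 q.1.2 q.1.1 j) ((p.1, fun n => g n p.2), fun n => i n ω)
        ∂((multivariateGaussian 0 V).prod P) = ∫⁻ x, F x ∂(multivariateGaussian 0 V) := by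
    conv_rhs => rw [← hg.map_chainFrom hV hVdiag (fun n => i n ω) j]
    rw [lintegral_map hF]
    · rfl
    · exact ((transition V _ j).continuous.measurable.comp measurable_fst).add
        ((hg.measurable_chain _ j).comp measurable_snd)
  simp only [h1, lintegral_const, measure_univ, mul_one]

lemma IsStdNoise.map_transition_add (hg : IsStdNoise P g) (hV : V.PosSemidef)
    (hVdiag : ∀ a, V a a = 1) (a : ℕ → Fin d) (m : ℕ) :
    ((multivariateGaussian 0 V).prod (P.map fun ω => chain V a (fun k => g k ω) m)).map
      (fun p => transition V a m p.1 + p.2) = multivariateGaussian 0 V := by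
  conv_rhs => rw [← hg.map_chainFrom hV hVdiag a m]
  conv_lhs => rw [← Measure.map_id (μ := multivariateGaussian 0 V)]
  have hc := hg.measurable_chain (V := V) a m
  rw [Measure.map_prod_map _ _ measurable_id hc, Measure.map_map (by fun_prop) (by fun_prop)]
  rfl

/-- For frozen indices, the stationary chain at time `j + m` is `M Y + Z`, where `Y ∼ N(0, V)` is
its state at time `j` and `Z` is the restarted chain, independent of `Y`. The Lipschitz property
bounds the conditional expectation; the contraction then averages over the indices. -/
lemma lintegral_coupling_le (hd : 0 < d) (hi : IsUniformIndices P i) (hg : IsStdNoise P g)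
    (hind : IndepFun (fun ω n => g n ω) (fun ω n => i n ω) P) (hV : V.PosDef)
    (hVdiag : ∀ a, V a a = 1)
    (hlam : IsLeast {μ : ℝ | Module.End.HasEigenvalue (Matrix.toLin' V) μ} lam)
    (hγ0 : 0 < γ) (hγ1 : γ ≤ 1) (hh : IsGaussianLipschitz κ γ V h) (j m : ℕ) :
    ∫⁻ p, ENNReal.ofReal
        ((h (stationaryChain V i g (j + m) p) - h (restartedChain V i g j m p)) ^ 2)
        ∂((multivariateGaussian 0 V).prod P) ≤
      ENNReal.ofReal (κ ^ 2 * ((d : ℝ) ^ 2 * (1 - lam / d) ^ m) ^ γ) := by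
  have hhm := hh.measurable
  have hm1 := measurable_chainFrom V (j + m)
  have hm2 := measurable_chain_shift V j m
  have hF : Measurable fun q : (Eucl d × (ℕ → ℝ)) × (ℕ → Fin d) =>
      ENNReal.ofReal ((h (chainFrom V q.2 q.1.2 q.1.1 (j + m)) -
        h (chain V (fun k => q.2 (j + k)) (fun k => q.1.2 (j + k)) m)) ^ 2) :=
    (((hhm.comp hm1).sub (hhm.comp hm2)).pow_const 2).ennreal_ofReal
  refine (lintegral_freeze hi.measurable hg.measurable hind hF).trans_le ?_
  have h1 (ω : Ω) : ∫⁻ p, ENNReal.ofReal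
      ((h (chainFrom V (fun n => i n ω) (fun n => g n p.2) p.1 (j + m)) -
        h (chain V (fun k => i (j + k) ω) (fun k => g (j + k) p.2) m)) ^ 2)
          ∂((multivariateGaussian 0 V).prod P) ≤
      ENNReal.ofReal (κ ^ 2) * ENNReal.ofReal
        ((∫ y, ‖transition V (fun k => i (j + k) ω) m y‖ ^ 2 ∂(multivariateGaussian 0 V)) ^ γ) := by
    rw [← ENNReal.ofReal_mul (sq_nonneg κ)]
    have hgauss := (hg.shift j).isGaussian_map_chain (V := V) (fun k => i (j + k) ω) m
    refine le_of_eq_of_le ?_ (hh.lintegral_le hV.posSemidef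
      (transition V (fun k => i (j + k) ω) m)
      ((hg.shift j).map_transition_add hV.posSemidef hVdiag (fun k => i (j + k) ω) m))
    -- The abstract `N(0, V)` is realised as the law of the stationary chain at time `j`, so that
    -- `map_pair` applies.
    conv_rhs =>
      enter [1, 1]
      rw [← hg.map_chainFrom hV.posSemidef hVdiag (fun n => i n ω) j]
    rw [← hg.map_pair, lintegral_map]
    · simp only [chainFrom_add]
      rfl
    · fun_prop
    · exact (((transition V _ j).continuous.measurable.comp measurable_fst).add
        ((hg.measurable_chain _ j).comp measurable_snd)).prodMk
          (((hg.shift j).measurable_chain _ m).comp measurable_snd)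
  refine (lintegral_mono h1).trans ?_
  rw [lintegral_const_mul' _ _ (by simp), ENNReal.ofReal_mul (sq_nonneg κ)]
  gcongr
  exact (hi.shift j).lintegral_rpow_norm_transition_le hd hV hVdiag hlam hγ0 hγ1 m

/-- For frozen indices the two factors are independent and the first is centered. Both vary with the
indices, yet the law of the first does not, so the conditional mean of the product always vanishes.
-/
lemma integral_mul_restartedChain_eq_zero (hi : IsUniformIndices P i) (hg : IsStdNoise P g)
    (hind : IndepFun (fun ω n => g n ω) (fun ω n => i n ω) P) (hV : V.PosSemidef)
    (hVdiag : ∀ a, V a a = 1) {f : Eucl d → ℝ} (hf : Measurable f)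
    (hf0 : ∫ x, f x ∂(multivariateGaussian 0 V) = 0) (j m : ℕ)
    (hint : Integrable (fun p => f (stationaryChain V i g j p) * f (restartedChain V i g j m p))
      ((multivariateGaussian 0 V).prod P)) :
    ∫ p, f (stationaryChain V i g j p) * f (restartedChain V i g j m p)
      ∂((multivariateGaussian 0 V).prod P) = 0 := by
  have hm1 := measurable_chainFrom V j
  have hm2 := measurable_chain_shift V j m
  refine integral_freeze_eq_zero hi.measurable hg.measurable hind
    (F := fun q => f (chainFrom V q.2 q.1.2 q.1.1 j) *
        f (chain V (fun k => q.2 (j + k)) (fun k => q.1.2 (j + k)) m))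
    ((hf.comp hm1).mul (hf.comp hm2)) hint fun a => ?_
  have hmeas : Measurable fun p : Eucl d × Ω => (chainFrom V a (fun k => g k p.2) p.1 j,
      chain V (fun k => a (j + k)) (fun k => g (j + k) p.2) m) :=
    (((transition V _ j).continuous.measurable.comp measurable_fst).add
        ((hg.measurable_chain _ j).comp measurable_snd)).prodMk
          (((hg.shift j).measurable_chain _ m).comp measurable_snd)
  have h1 := integral_map (μ := (multivariateGaussian 0 V).prod P) hmeas.aemeasurable
    (f := fun q : Eucl d × Eucl d => f q.1 * f q.2) (by fun_prop)
  refine h1.symm.trans ?_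
  rw [hg.map_pair, hg.map_chainFrom hV hVdiag, integral_prod_mul, hf0, zero_mul]

end Coupling

/-! ### Second moments of sums with geometrically decaying correlations -/

section SecondMoments

variable {Ω : Type*} [MeasurableSpace Ω] {μ : Measure Ω}

/-- Cauchy–Schwarz: the quadratic polynomial `t ↦ ∫ (t g + f) ^ 2` is nonnegative, so its
discriminant is nonpositive. -/
lemma sq_integral_mul_le {f g : Ω → ℝ} (hf : MemLp f 2 μ) (hg : MemLp g 2 μ) :
    (∫ ω, f ω * g ω ∂μ) ^ 2 ≤ (∫ ω, f ω ^ 2 ∂μ) * ∫ ω, g ω ^ 2 ∂μ := by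
  have key (t : ℝ) : 0 ≤ (∫ ω, g ω ^ 2 ∂μ) * (t * t) + (2 * ∫ ω, f ω * g ω ∂μ) * t +
      ∫ ω, f ω ^ 2 ∂μ := by
    have h1 := hg.integrable_sq.const_mul (t * t)
    have h2 := (hf.integrable_mul hg).const_mul (2 * t)
    have h3 := hf.integrable_sq
    have h4 : ∫ ω, (t * t * g ω ^ 2 + 2 * t * (f ω * g ω) + f ω ^ 2) ∂μ =
        t * t * (∫ ω, g ω ^ 2 ∂μ) + 2 * t * (∫ ω, f ω * g ω ∂μ) + ∫ ω, f ω ^ 2 ∂μ := by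
      rw [← integral_const_mul, ← integral_const_mul]
      exact (integral_add (h1.add h2) h3).trans
        (congrArg (· + _) (integral_add h1 h2))
    have h5 : 0 ≤ ∫ ω, (t * t * g ω ^ 2 + 2 * t * (f ω * g ω) + f ω ^ 2) ∂μ :=
      integral_nonneg fun ω => by
        have : t * t * g ω ^ 2 + 2 * t * (f ω * g ω) + f ω ^ 2 = (t * g ω + f ω) ^ 2 := by ring
        simp only [this]
        exact sq_nonneg _
    rw [h4] at h5
    linarith
  have := discrim_le_zero key
  rw [discrim] at this
  linarith

lemma abs_integral_mul_le {f g : Ω → ℝ} (hf : MemLp f 2 μ) (hg : MemLp g 2 μ) {a b : ℝ}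
    (ha : 0 ≤ a) (hb : 0 ≤ b) (hfa : ∫ ω, f ω ^ 2 ∂μ ≤ a ^ 2) (hgb : ∫ ω, g ω ^ 2 ∂μ ≤ b ^ 2) :
    |∫ ω, f ω * g ω ∂μ| ≤ a * b := by
  refine abs_le_of_sq_le_sq ?_ (by positivity)
  calc _ ≤ (∫ ω, f ω ^ 2 ∂μ) * ∫ ω, g ω ^ 2 ∂μ := sq_integral_mul_le hf hg
    _ ≤ a ^ 2 * b ^ 2 := mul_le_mul hfa hgb (integral_nonneg fun ω => sq_nonneg _) (sq_nonneg a)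
    _ = _ := by ring

lemma integral_sq_sum {ι : Type*} (s : Finset ι) {B : ι → Ω → ℝ} (hB : ∀ j ∈ s, MemLp (B j) 2 μ) :
    ∫ ω, (∑ j ∈ s, B j ω) ^ 2 ∂μ = ∑ j ∈ s, ∑ k ∈ s, ∫ ω, B j ω * B k ω ∂μ := by
  have hint (j) (hj : j ∈ s) (k) (hk : k ∈ s) : Integrable (fun ω => B j ω * B k ω) μ :=
    (hB j hj).integrable_mul (hB k hk)
  simp only [pow_two, Finset.sum_mul_sum]
  rw [integral_finsetSum _ fun j hj => integrable_finsetSum _ fun k hk => hint j hj k hk]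
  exact Finset.sum_congr rfl fun j hj => integral_finsetSum _ fun k hk => hint j hj k hk

/-- Minkowski's inequality in `L²`, obtained by expanding the square and applying Cauchy–Schwarz to
each product. -/
lemma integral_sq_sum_le {ι : Type*} (s : Finset ι) {B : ι → Ω → ℝ} {e : ι → ℝ}
    (hB : ∀ j ∈ s, MemLp (B j) 2 μ) (he : ∀ j ∈ s, 0 ≤ e j)
    (hBe : ∀ j ∈ s, ∫ ω, B j ω ^ 2 ∂μ ≤ e j ^ 2) :
    ∫ ω, (∑ j ∈ s, B j ω) ^ 2 ∂μ ≤ (∑ j ∈ s, e j) ^ 2 := by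
  rw [integral_sq_sum s hB, pow_two, Finset.sum_mul_sum]
  exact Finset.sum_le_sum fun j hj => Finset.sum_le_sum fun k hk => (le_abs_self _).trans
    (abs_integral_mul_le (hB j hj) (hB k hk) (he j hj) (he k hk) (hBe j hj) (hBe k hk))

lemma sum_range_sub_add_le {c : ℕ → ℝ} (hc : ∀ m, 0 ≤ c m) {j n : ℕ} (hj : j ≤ n) :
    ∑ k ∈ Finset.range j, c (j - k) + ∑ k ∈ Finset.Ico j n, c (k - j) ≤
      2 * ∑ m ∈ Finset.range (n + 1), c m := by
  have h1 : ∑ k ∈ Finset.range j, c (j - k) ≤ ∑ m ∈ Finset.range (n + 1), c m := by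
    calc ∑ k ∈ Finset.range j, c (j - k) ≤ ∑ k ∈ Finset.range (j + 1), c (j + 1 - 1 - k) := by
          simp only [Nat.add_sub_cancel]
          exact Finset.sum_le_sum_of_subset_of_nonneg (by simp) fun _ _ _ => hc _
      _ = ∑ k ∈ Finset.range (j + 1), c k := Finset.sum_range_reflect c (j + 1)
      _ ≤ _ := Finset.sum_le_sum_of_subset_of_nonneg
          (Finset.range_subset_range.2 (by omega)) fun _ _ _ => hc _
  have h2 : ∑ k ∈ Finset.Ico j n, c (k - j) ≤ ∑ m ∈ Finset.range (n + 1), c m := by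
    rw [Finset.sum_Ico_eq_sum_range]
    simp only [Nat.add_sub_cancel_left]
    exact Finset.sum_le_sum_of_subset_of_nonneg
      (Finset.range_subset_range.2 (by omega)) fun _ _ _ => hc _
  linarith

lemma integral_sq_sum_Ico_le {B : ℕ → Ω → ℝ} (hB : ∀ j, MemLp (B j) 2 μ) {c : ℕ → ℝ}
    (hc : ∀ m, 0 ≤ c m) (hBc : ∀ j m, |∫ ω, B j ω * B (j + m) ω ∂μ| ≤ c m) (a n : ℕ) :
    ∫ ω, (∑ j ∈ Finset.Ico a n, B j ω) ^ 2 ∂μ ≤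
      (n - a : ℕ) * (2 * ∑ m ∈ Finset.range (n + 1), c m) := by
  rw [integral_sq_sum _ fun j _ => hB j]
  have hrow (j) (hj : j ∈ Finset.Ico a n) : ∑ k ∈ Finset.Ico a n, ∫ ω, B j ω * B k ω ∂μ ≤
      2 * ∑ m ∈ Finset.range (n + 1), c m := by
    have hjn : j ≤ n := (Finset.mem_Ico.1 hj).2.le
    calc ∑ k ∈ Finset.Ico a n, ∫ ω, B j ω * B k ω ∂μ
        ≤ ∑ k ∈ Finset.Ico a n, |∫ ω, B j ω * B k ω ∂μ| :=
          Finset.sum_le_sum fun k _ => le_abs_self _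
      _ ≤ ∑ k ∈ Finset.range n, |∫ ω, B j ω * B k ω ∂μ| :=
          Finset.sum_le_sum_of_subset_of_nonneg
            (fun k hk => Finset.mem_range.2 (Finset.mem_Ico.1 hk).2) fun _ _ _ => abs_nonneg _
      _ = ∑ k ∈ Finset.range j, |∫ ω, B j ω * B k ω ∂μ| +
          ∑ k ∈ Finset.Ico j n, |∫ ω, B j ω * B k ω ∂μ| := by
          rw [Finset.sum_range_add_sum_Ico _ hjn]
      _ ≤ ∑ k ∈ Finset.range j, c (j - k) + ∑ k ∈ Finset.Ico j n, c (k - j) := by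
          gcongr with k hk k hk
          · have hkj : k + (j - k) = j := by have := Finset.mem_range.1 hk; omega
            have := hBc k (j - k)
            rw [hkj] at this
            simpa only [mul_comm (B j _)] using this
          · have hjk : j + (k - j) = k := by have := Finset.mem_Ico.1 hk; omega
            simpa only [hjk] using hBc j (k - j)
      _ ≤ _ := sum_range_sub_add_le hc hjn
  refine (Finset.sum_le_sum hrow).trans_eq ?_
  simp

lemma sum_geometric_Ico_le {r : ℝ} (hr0 : 0 ≤ r) (hr1 : r < 1) (a n : ℕ) :
    ∑ j ∈ Finset.Ico a n, r ^ j ≤ r ^ a / (1 - r) :=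
  geom_sum_Ico_le_of_lt_one hr0 hr1

/-- The mean squared error of an average of `A j`, where `A j` is exponentially close in `L²` to a
process `B j` with exponentially decaying correlations. -/
lemma integral_sq_average_le {A B : ℕ → Ω → ℝ} (hA : ∀ j, MemLp (A j) 2 μ)
    (hB : ∀ j, MemLp (B j) 2 μ) {K S r : ℝ} (hK : 0 ≤ K) (hS : 0 ≤ S) (hr0 : 0 ≤ r) (hr1 : r < 1)
    (hAB : ∀ j, ∫ ω, (A j ω - B j ω) ^ 2 ∂μ ≤ (K * r ^ j) ^ 2)
    (hBS : ∀ j, ∫ ω, B j ω ^ 2 ∂μ ≤ S ^ 2)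
    (hBB : ∀ j m, |∫ ω, B j ω * B (j + m) ω ∂μ| ≤ S * (K * r ^ m)) {δ k : ℕ}
    (hδ : K * r ^ δ / (1 - r) ≤ S * δ) (hk : δ < k) :
    ∫ ω, ((∑ j ∈ Finset.Ico k (2 * k), A j ω) / k) ^ 2 ∂μ ≤ 10 * (δ * S ^ 2 / k) := by
  have hr : 0 < 1 - r := by linarith
  have hk0 : (0 : ℝ) < k := by exact_mod_cast (Nat.zero_le δ).trans_lt hk
  have hδk : (δ : ℝ) ≤ k := by exact_mod_cast hk.le
  have hD (j : ℕ) : MemLp (fun ω => A j ω - B j ω) 2 μ := (hA j).sub (hB j)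
  have h1 : ∫ ω, (∑ j ∈ Finset.Ico k (2 * k), (A j ω - B j ω)) ^ 2 ∂μ ≤ (S * δ) ^ 2 := by
    refine (integral_sq_sum_le _ (fun j _ => hD j) (e := fun j => K * r ^ j)
      (fun j _ => by positivity) fun j _ => hAB j).trans ?_
    gcongr
    rw [← Finset.mul_sum]
    refine le_trans ?_ hδ
    rw [mul_div_assoc]
    gcongr
    refine (sum_geometric_Ico_le hr0 hr1 _ _).trans ?_
    gcongr ?_ / _
    exact pow_le_pow_of_le_one hr0 hr1.le hk.le
  have h2 : ∫ ω, (∑ j ∈ Finset.Ico k (2 * k), B j ω) ^ 2 ∂μ ≤ k * (4 * (δ * S ^ 2)) := by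
    -- Each covariance has two bounds: `S ^ 2` by Cauchy–Schwarz, used for lags below `δ`, and the
    -- geometric one, used from lag `δ` on. Each range contributes at most `δ * S ^ 2`, and lags of
    -- both signs double the sum.
    have hc0 (m : ℕ) : 0 ≤ min (S * S) (S * (K * r ^ m)) := le_min (by positivity) (by positivity)
    refine (integral_sq_sum_Ico_le hB hc0 (fun j m => le_min
      (abs_integral_mul_le (hB j) (hB (j + m)) hS hS (hBS j) (hBS _)) (hBB j m)) _ _).trans ?_
    have hk2 : 2 * k - k = k := by omega
    rw [hk2, ← Finset.sum_range_add_sum_Ico _ (show δ ≤ 2 * k + 1 by omega)]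
    have h3 : ∑ m ∈ Finset.range δ, min (S * S) (S * (K * r ^ m)) ≤ δ * S ^ 2 := by
      refine (Finset.sum_le_sum fun m _ => min_le_left _ _).trans_eq ?_
      rw [Finset.sum_const, Finset.card_range, nsmul_eq_mul]
      ring
    have h4 : ∑ m ∈ Finset.Ico δ (2 * k + 1), min (S * S) (S * (K * r ^ m)) ≤ δ * S ^ 2 := by
      refine (Finset.sum_le_sum fun m _ => min_le_right _ _).trans ?_
      rw [← Finset.mul_sum, ← Finset.mul_sum]
      calc S * (K * ∑ m ∈ Finset.Ico δ (2 * k + 1), r ^ m)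
          ≤ S * (K * (r ^ δ / (1 - r))) := by
            gcongr
            exact sum_geometric_Ico_le hr0 hr1 _ _
        _ ≤ S * (S * δ) := by
            rw [← mul_div_assoc]
            gcongr
        _ = δ * S ^ 2 := by ring
    exact mul_le_mul_of_nonneg_left (by linarith) hk0.le
  have hi1 : Integrable (fun ω => (∑ j ∈ Finset.Ico k (2 * k), (A j ω - B j ω)) ^ 2) μ :=
    (memLp_finsetSum _ fun j _ => hD j).integrable_sq
  have hi2 : Integrable (fun ω => (∑ j ∈ Finset.Ico k (2 * k), B j ω) ^ 2) μ :=
    (memLp_finsetSum _ fun j _ => hB j).integrable_sq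
  calc ∫ ω, ((∑ j ∈ Finset.Ico k (2 * k), A j ω) / k) ^ 2 ∂μ
      ≤ ∫ ω, 2 / (k : ℝ) ^ 2 * ((∑ j ∈ Finset.Ico k (2 * k), (A j ω - B j ω)) ^ 2 +
          (∑ j ∈ Finset.Ico k (2 * k), B j ω) ^ 2) ∂μ := by
        refine integral_mono_of_nonneg (.of_forall fun ω => sq_nonneg _)
          ((hi1.add hi2).const_mul _) (.of_forall fun ω => ?_)
        simp only [Finset.sum_sub_distrib]
        rw [div_pow, div_mul_eq_mul_div]
        gcongr
        -- With `x = ∑ A` and `y = ∑ B`, `2 (x - y)² + 2 y² - x² = (x - 2 y)²`.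
        nlinarith [sq_nonneg (∑ j ∈ Finset.Ico k (2 * k), A j ω -
          2 * ∑ j ∈ Finset.Ico k (2 * k), B j ω)]
    _ = 2 / (k : ℝ) ^ 2 * (∫ ω, (∑ j ∈ Finset.Ico k (2 * k), (A j ω - B j ω)) ^ 2 ∂μ +
          ∫ ω, (∑ j ∈ Finset.Ico k (2 * k), B j ω) ^ 2 ∂μ) := by
        rw [integral_const_mul, integral_add hi1 hi2]
    _ ≤ 2 / (k : ℝ) ^ 2 * ((S * δ) ^ 2 + k * (4 * (δ * S ^ 2))) := by gcongr
    _ ≤ 2 / (k : ℝ) ^ 2 * (k * (δ * S ^ 2) + k * (4 * (δ * S ^ 2))) := by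
        gcongr
        calc (S * δ) ^ 2 = δ * (δ * S ^ 2) := by ring
          _ ≤ k * (δ * S ^ 2) := by gcongr
    _ = 10 * (δ * S ^ 2 / k) := by
        field_simp
        ring

/-- The mean of an average of `A j`, where `A j` is exponentially close in `L²` to a centered
process `B j`. -/
lemma abs_integral_average_le [IsProbabilityMeasure μ] {A B : ℕ → Ω → ℝ}
    (hA : ∀ j, MemLp (A j) 2 μ) (hB : ∀ j, MemLp (B j) 2 μ) {K r : ℝ} (hK : 0 ≤ K)
    (hr0 : 0 ≤ r) (hr1 : r < 1)
    (hAB : ∀ j, ∫ ω, (A j ω - B j ω) ^ 2 ∂μ ≤ (K * r ^ j) ^ 2)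
    (hB0 : ∀ j, ∫ ω, B j ω ∂μ = 0) (k n : ℕ) :
    |∫ ω, (∑ j ∈ Finset.Ico k n, A j ω) / k ∂μ| ≤ K * r ^ k / (1 - r) / k := by
  have hr : 0 < 1 - r := by linarith
  have hj (j : ℕ) : |∫ ω, A j ω ∂μ| ≤ K * r ^ j := by
    have h1 : ∫ ω, A j ω ∂μ = ∫ ω, (A j ω - B j ω) * 1 ∂μ := by
      simp only [mul_one]
      rw [integral_sub ((hA j).integrable (by simp)) ((hB j).integrable (by simp)), hB0, sub_zero]
    rw [h1]
    refine (abs_integral_mul_le ((hA j).sub (hB j)) (memLp_const 1) (by positivity) zero_le_one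
      (hAB j) (by simp)).trans_eq (mul_one _)
  rw [integral_div, integral_finsetSum _ fun j _ => (hA j).integrable (by simp), abs_div,
    Nat.abs_cast]
  gcongr
  calc |∑ j ∈ Finset.Ico k n, ∫ ω, A j ω ∂μ| ≤ ∑ j ∈ Finset.Ico k n, |∫ ω, A j ω ∂μ| :=
        Finset.abs_sum_le_sum_abs _ _
    _ ≤ ∑ j ∈ Finset.Ico k n, K * r ^ j := Finset.sum_le_sum fun j _ => hj j
    _ ≤ K * r ^ k / (1 - r) := by
        rw [← Finset.mul_sum, mul_div_assoc]
        gcongr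
        exact sum_geometric_Ico_le hr0 hr1 _ _

end SecondMoments

/-! ### Moments of `h` under `N(0, V)` -/

section LipschitzMoments

variable {d : ℕ} {V : Matrix (Fin d) (Fin d) ℝ} {κ γ : ℝ} {h : Eucl d → ℝ}

lemma memLp_two_of_lintegral_sq_le {Ω : Type*} [MeasurableSpace Ω] {μ : Measure Ω} {f : Ω → ℝ}
    (hf : AEStronglyMeasurable f μ) {c : ℝ}
    (hc : ∫⁻ ω, ENNReal.ofReal (f ω ^ 2) ∂μ ≤ ENNReal.ofReal c) : MemLp f 2 μ := by
  rw [memLp_two_iff_integrable_sq hf]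
  refine ⟨hf.pow 2, ?_⟩
  rw [hasFiniteIntegral_iff_ofReal (.of_forall fun ω => sq_nonneg _)]
  exact hc.trans_lt ENNReal.ofReal_lt_top

lemma integral_sq_le_of_lintegral_sq_le {Ω : Type*} [MeasurableSpace Ω] {μ : Measure Ω}
    {f : Ω → ℝ} (hf : AEStronglyMeasurable f μ) {c : ℝ} (hc0 : 0 ≤ c)
    (hc : ∫⁻ ω, ENNReal.ofReal (f ω ^ 2) ∂μ ≤ ENNReal.ofReal c) : ∫ ω, f ω ^ 2 ∂μ ≤ c := by
  rw [integral_eq_lintegral_of_nonneg_ae (.of_forall fun ω => sq_nonneg _) (hf.pow 2)]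
  exact ENNReal.toReal_le_of_le_ofReal hc0 hc

lemma integral_norm_sq_multivariateGaussian (hV : V.PosSemidef) (hVdiag : ∀ a, V a a = 1) :
    ∫ y, ‖y‖ ^ 2 ∂(multivariateGaussian 0 V) = d := by
  have hm (a : Fin d) := IsGaussian.memLp_apply (multivariateGaussian 0 V)
    (ContinuousLinearMap.id ℝ (Eucl d)) a
  have hint (a : Fin d) : Integrable (fun y : Eucl d => y a ^ 2) (multivariateGaussian 0 V) :=
    (hm a).integrable_sq
  have hcov (a : Fin d) : ∫ y : Eucl d, y a ^ 2 ∂(multivariateGaussian 0 V) = 1 := by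
    have := congrFun₂ (covMatrix_multivariateGaussian hV) a a
    simpa [covMatrix, hVdiag, pow_two] using this
  simp only [EuclideanSpace.real_norm_sq_eq]
  rw [integral_finsetSum _ fun a _ => hint a]
  simp [hcov]

/-- The Lipschitz property is applied with `M` the identity and `Z = 0`, so that `E ‖Y‖² = tr V =
d`. -/
lemma IsGaussianLipschitz.lintegral_sub_zero_le (hh : IsGaussianLipschitz κ γ V h)
    (hV : V.PosSemidef) (hVdiag : ∀ a, V a a = 1) :
    ∫⁻ y, ENNReal.ofReal ((h y - h 0) ^ 2) ∂(multivariateGaussian 0 V) ≤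
      ENNReal.ofReal (κ ^ 2 * (d : ℝ) ^ γ) := by
  have hhm := hh.measurable
  have := hh.lintegral_le hV (ContinuousLinearMap.id ℝ (Eucl d)) (ν := Measure.dirac 0)
    (by
      rw [Measure.prod_dirac, Measure.map_map (by fun_prop) (by fun_prop)]
      convert Measure.map_id using 2
      ext1 y
      simp)
  simp only [ContinuousLinearMap.id_apply, integral_norm_sq_multivariateGaussian hV hVdiag] at this
  rw [Measure.prod_dirac, lintegral_map (by fun_prop) (by fun_prop)] at this
  simpa using this

lemma IsGaussianLipschitz.memLp (hh : IsGaussianLipschitz κ γ V h)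
    (hV : V.PosSemidef) (hVdiag : ∀ a, V a a = 1) : MemLp h 2 (multivariateGaussian 0 V) := by
  have hhm := hh.measurable
  have h1 := memLp_two_of_lintegral_sq_le (by fun_prop) (hh.lintegral_sub_zero_le hV hVdiag)
  have := h1.add (memLp_const (h 0))
  refine this.congr_norm (by fun_prop) (.of_forall fun y => by simp)

lemma IsGaussianLipschitz.gaussianStd_sq_le (hh : IsGaussianLipschitz κ γ V h)
    (hV : V.PosSemidef) (hVdiag : ∀ a, V a a = 1) :
    gaussianStd V h ^ 2 ≤ κ ^ 2 * (d : ℝ) ^ γ := by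
  have hhm := hh.measurable
  rw [gaussianStd, Real.sq_sqrt (variance_nonneg _ _),
    ← variance_sub_const hhm.aestronglyMeasurable (h 0)]
  exact (variance_le_expectation_sq (by fun_prop)).trans
    (integral_sq_le_of_lintegral_sq_le (by fun_prop) (by positivity)
      (hh.lintegral_sub_zero_le hV hVdiag))

end LipschitzMoments

/-! ### Coupling and covariance bounds in `L²` -/

section CenteredChain

variable {Ω : Type*} [MeasurableSpace Ω] {P : Measure Ω} [IsProbabilityMeasure P]
  {d : ℕ} {V : Matrix (Fin d) (Fin d) ℝ} {lam κ γ : ℝ} {h : Eucl d → ℝ}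
  {i : ℕ → Ω → Fin d} {g : ℕ → Ω → ℝ}

lemma IsGaussianLipschitz.memLp_stationaryChain (hi : IsUniformIndices P i) (hg : IsStdNoise P g)
    (hind : IndepFun (fun ω n => g n ω) (fun ω n => i n ω) P) (hV : V.PosSemidef)
    (hVdiag : ∀ a, V a a = 1) (hh : IsGaussianLipschitz κ γ V h) (j : ℕ) :
    MemLp (fun p => h (stationaryChain V i g j p)) 2 ((multivariateGaussian 0 V).prod P) := by
  have hX := measurable_stationaryChain V hi.measurable hg.measurable j
  have := hh.memLp hV hVdiag
  rw [← map_stationaryChain hi hg hind hV hVdiag j] at this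
  exact this.comp_of_map hX.aemeasurable

lemma integral_stationaryChain (hi : IsUniformIndices P i) (hg : IsStdNoise P g)
    (hind : IndepFun (fun ω n => g n ω) (fun ω n => i n ω) P) (hV : V.PosSemidef)
    (hVdiag : ∀ a, V a a = 1) {f : Eucl d → ℝ} (hf : Measurable f) (j : ℕ) :
    ∫ p, f (stationaryChain V i g j p) ∂((multivariateGaussian 0 V).prod P) =
      ∫ x, f x ∂(multivariateGaussian 0 V) := by
  have hX := measurable_stationaryChain V hi.measurable hg.measurable j
  conv_rhs => rw [← map_stationaryChain hi hg hind hV hVdiag j]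
  rw [integral_map hX.aemeasurable hf.aestronglyMeasurable]

lemma coupling_bound_eq (hd : 0 < d) (hV : V.PosDef) (hVdiag : ∀ a, V a a = 1)
    (hlam : IsLeast {μ : ℝ | Module.End.HasEigenvalue (Matrix.toLin' V) μ} lam) (m : ℕ) :
    κ ^ 2 * ((d : ℝ) ^ 2 * (1 - lam / d) ^ m) ^ γ =
      (κ * (d : ℝ) ^ γ * ((1 - lam / d) ^ (γ / 2)) ^ m) ^ 2 := by
  have hlam1 := leastEigenvalue_le_one hV hVdiag hlam ⟨0, hd⟩
  have hd' : (1 : ℝ) ≤ d := by exact_mod_cast hd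
  have hs : 0 ≤ 1 - lam / d := by
    rw [sub_nonneg, div_le_one (by linarith)]
    linarith
  rw [Real.mul_rpow (by positivity) (by positivity), mul_pow, mul_pow, mul_assoc]
  congr 2
  · rw [← Real.rpow_natCast, ← Real.rpow_natCast, ← Real.rpow_mul (by positivity),
      ← Real.rpow_mul (by positivity), mul_comm]
  · rw [← Real.rpow_natCast, ← Real.rpow_natCast, ← Real.rpow_natCast,
      ← Real.rpow_mul hs, ← Real.rpow_mul hs, ← Real.rpow_mul hs]
    congr 1
    push_cast
    ring

/-- Square-integrability of `h` along a chain started at `0` is not known beforehand: it follows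
from that of the stationary chain and of this difference. -/
lemma memLp_coupling (hd : 0 < d) (hi : IsUniformIndices P i) (hg : IsStdNoise P g)
    (hind : IndepFun (fun ω n => g n ω) (fun ω n => i n ω) P) (hV : V.PosDef)
    (hVdiag : ∀ a, V a a = 1)
    (hlam : IsLeast {μ : ℝ | Module.End.HasEigenvalue (Matrix.toLin' V) μ} lam)
    (hγ0 : 0 < γ) (hγ1 : γ ≤ 1) (hh : IsGaussianLipschitz κ γ V h) (j m : ℕ) :
    MemLp (fun p => h (stationaryChain V i g (j + m) p) - h (restartedChain V i g j m p)) 2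
      ((multivariateGaussian 0 V).prod P) := by
  have h1 := hh.measurable.comp (measurable_stationaryChain V hi.measurable hg.measurable (j + m))
  have h2 := hh.measurable.comp (measurable_restartedChain V hi.measurable hg.measurable j m)
  exact memLp_two_of_lintegral_sq_le (h1.sub h2).aestronglyMeasurable
    (lintegral_coupling_le hd hi hg hind hV hVdiag hlam hγ0 hγ1 hh j m)

lemma integral_coupling_sq_le (hd : 0 < d) (hi : IsUniformIndices P i) (hg : IsStdNoise P g)
    (hind : IndepFun (fun ω n => g n ω) (fun ω n => i n ω) P) (hV : V.PosDef)
    (hVdiag : ∀ a, V a a = 1)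
    (hlam : IsLeast {μ : ℝ | Module.End.HasEigenvalue (Matrix.toLin' V) μ} lam)
    (hγ0 : 0 < γ) (hγ1 : γ ≤ 1) (hh : IsGaussianLipschitz κ γ V h) (j m : ℕ) :
    ∫ p, (h (stationaryChain V i g (j + m) p) - h (restartedChain V i g j m p)) ^ 2
        ∂((multivariateGaussian 0 V).prod P) ≤
      (κ * (d : ℝ) ^ γ * ((1 - lam / d) ^ (γ / 2)) ^ m) ^ 2 := by
  have h1 := hh.measurable.comp (measurable_stationaryChain V hi.measurable hg.measurable (j + m))
  have h2 := hh.measurable.comp (measurable_restartedChain V hi.measurable hg.measurable j m)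
  rw [← coupling_bound_eq hd hV hVdiag hlam]
  refine integral_sq_le_of_lintegral_sq_le (h1.sub h2).aestronglyMeasurable ?_
    (lintegral_coupling_le hd hi hg hind hV hVdiag hlam hγ0 hγ1 hh j m)
  rw [coupling_bound_eq hd hV hVdiag hlam]
  positivity

lemma integral_sq_centered (hi : IsUniformIndices P i) (hg : IsStdNoise P g)
    (hind : IndepFun (fun ω n => g n ω) (fun ω n => i n ω) P) (hV : V.PosSemidef)
    (hVdiag : ∀ a, V a a = 1) (hh : Measurable h) (j : ℕ) :
    ∫ p, (h (stationaryChain V i g j p) - gaussianMean V h) ^ 2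
      ∂((multivariateGaussian 0 V).prod P) = gaussianStd V h ^ 2 := by
  rw [integral_stationaryChain hi hg hind hV hVdiag (f := fun x => (h x - gaussianMean V h) ^ 2)
    (by fun_prop), gaussianStd, Real.sq_sqrt (variance_nonneg _ _),
    variance_eq_integral hh.aemeasurable]
  rfl

/-- Replacing `h` at time `j + m` by its difference with the restarted chain leaves the covariance
unchanged, by `integral_mul_restartedChain_eq_zero`. Cauchy–Schwarz and the coupling bound finish.
-/
lemma abs_integral_mul_centered_le (hd : 0 < d) (hi : IsUniformIndices P i) (hg : IsStdNoise P g)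
    (hind : IndepFun (fun ω n => g n ω) (fun ω n => i n ω) P) (hV : V.PosDef)
    (hVdiag : ∀ a, V a a = 1)
    (hlam : IsLeast {μ : ℝ | Module.End.HasEigenvalue (Matrix.toLin' V) μ} lam) (hκ : 0 < κ)
    (hγ0 : 0 < γ) (hγ1 : γ ≤ 1) (hh : IsGaussianLipschitz κ γ V h) (j m : ℕ) :
    |∫ p, (h (stationaryChain V i g j p) - gaussianMean V h) *
        (h (stationaryChain V i g (j + m) p) - gaussianMean V h)
        ∂((multivariateGaussian 0 V).prod P)| ≤
      gaussianStd V h * (κ * (d : ℝ) ^ γ * ((1 - lam / d) ^ (γ / 2)) ^ m) := by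
  have hlam1 := leastEigenvalue_le_one hV hVdiag hlam ⟨0, hd⟩
  have hd' : (1 : ℝ) ≤ d := by exact_mod_cast hd
  have hs : 0 ≤ 1 - lam / d := by
    rw [sub_nonneg, div_le_one (by linarith)]
    linarith
  have hhm := hh.measurable
  have hX (j : ℕ) : MemLp (fun p => h (stationaryChain V i g j p) - gaussianMean V h) 2
      ((multivariateGaussian 0 V).prod P) :=
    (hh.memLp_stationaryChain hi hg hind hV.posSemidef hVdiag j).sub (memLp_const _)
  have hD := memLp_coupling hd hi hg hind hV hVdiag hlam hγ0 hγ1 hh j m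
  have hZ : MemLp (fun p => h (restartedChain V i g j m p) - gaussianMean V h) 2
      ((multivariateGaussian 0 V).prod P) := by
    refine ((hX (j + m)).sub hD).congr_norm ?_ (.of_forall fun p => by simp)
    exact ((hhm.comp (measurable_restartedChain V hi.measurable hg.measurable j m)).sub_const
      _).aestronglyMeasurable
  have h0 : ∫ x, (h x - gaussianMean V h) ∂(multivariateGaussian 0 V) = 0 := by
    rw [integral_sub ((hh.memLp hV.posSemidef hVdiag).integrable (by simp)) (integrable_const _)]
    simp [gaussianMean]
  have hzero := integral_mul_restartedChain_eq_zero hi hg hind hV.posSemidef hVdiag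
    (f := fun x => h x - gaussianMean V h) (by fun_prop) h0 j m ((hX j).integrable_mul hZ)
  have hsplit : ∫ p, (h (stationaryChain V i g j p) - gaussianMean V h) *
        (h (stationaryChain V i g (j + m) p) - gaussianMean V h)
        ∂((multivariateGaussian 0 V).prod P) =
      ∫ p, (h (stationaryChain V i g j p) - gaussianMean V h) *
        (h (stationaryChain V i g (j + m) p) - h (restartedChain V i g j m p))
        ∂((multivariateGaussian 0 V).prod P) := by
    have := integral_add ((hX j).integrable_mul hD) ((hX j).integrable_mul hZ)
    simp only [Pi.mul_apply] at this
    rw [hzero, add_zero] at this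
    rw [← this]
    congr 1
    ext1 p
    ring
  rw [hsplit]
  exact abs_integral_mul_le (hX j) hD (Real.sqrt_nonneg _) (by positivity)
    (integral_sq_centered hi hg hind hV.posSemidef hVdiag hhm j).le
    (integral_coupling_sq_le hd hi hg hind hV hVdiag hlam hγ0 hγ1 hh j m)

end CenteredChain

/-! ### Rates and the choice of `δ` -/

section Constants

variable {d : ℕ} {lam γ κ S : ℝ}

/-- Bernoulli's inequality for the exponent `γ / 2 ≤ 1`. -/
lemma one_sub_rate_ge (hd : 0 < d) (hlam0 : 0 < lam) (hlam1 : lam ≤ 1) (hγ0 : 0 < γ)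
    (hγ1 : γ ≤ 1) : lam * γ / (2 * d) ≤ 1 - (1 - lam / d) ^ (γ / 2) := by
  have hd' : (1 : ℝ) ≤ d := by exact_mod_cast hd
  have hs : lam / d ≤ 1 := by
    rw [div_le_one (by linarith)]
    linarith
  have := rpow_one_add_le_one_add_mul_self (s := -(lam / d)) (by linarith)
    (p := γ / 2) (by linarith) (by linarith)
  rw [← sub_eq_add_neg] at this
  have h2 : γ / 2 * -(lam / d) = -(lam * γ / (2 * d)) := by field_simp
  linarith

lemma rate_pow_le (hd : 0 < d) (hlam1 : lam ≤ 1) (hγ0 : 0 < γ) (m : ℕ) :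
    ((1 - lam / d) ^ (γ / 2)) ^ m ≤ Real.exp (-(lam * γ / (2 * d) * m)) := by
  have hd' : (1 : ℝ) ≤ d := by exact_mod_cast hd
  have hs : 0 ≤ 1 - lam / d := by
    rw [sub_nonneg, div_le_one (by linarith)]
    linarith
  have h1 : (1 - lam / d) ^ (γ / 2) ≤ Real.exp (-(lam * γ / (2 * d))) := by
    calc (1 - lam / d) ^ (γ / 2) ≤ Real.exp (-(lam / d)) ^ (γ / 2) :=
          Real.rpow_le_rpow hs (Real.one_sub_le_exp_neg _) (by linarith)
      _ = Real.exp (-(lam * γ / (2 * d))) := by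
          rw [← Real.exp_mul]
          congr 1
          field_simp
  calc ((1 - lam / d) ^ (γ / 2)) ^ m ≤ Real.exp (-(lam * γ / (2 * d))) ^ m :=
        pow_le_pow_left₀ (by positivity) h1 m
    _ = _ := by
        rw [← Real.exp_nat_mul]
        congr 1
        ring

/-- With `ρ = S / (κ d)`, the choice of `δ` gives `r ^ δ ≤ ρ ^ 2`. One factor `ρ` turns `κ d` into
`S`; the other is absorbed by `ρ ≤ 2 log (1 / ρ)`. -/
lemma mixing_time_bound (hd : 3 ≤ d) (hlam0 : 0 < lam) (hlam1 : lam ≤ 1) (hγ0 : 0 < γ)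
    (hγ1 : γ ≤ 1) (hκ : 0 < κ) (hS : 0 < S) (hSκ : S ^ 2 ≤ κ ^ 2 * (d : ℝ) ^ γ) {δ : ℕ}
    (hδ : 4 * (lam * γ)⁻¹ * d * Real.log (κ * d / S) ≤ δ) :
    κ * (d : ℝ) ^ γ * ((1 - lam / d) ^ (γ / 2)) ^ δ / (1 - (1 - lam / d) ^ (γ / 2)) ≤ S * δ := by
  have hd3 : (3 : ℝ) ≤ d := by exact_mod_cast hd
  have hd0 : (0 : ℝ) < d := by linarith
  have hdγ : (d : ℝ) ^ γ ≤ d := by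
    simpa using Real.rpow_le_rpow_of_exponent_le (by linarith : (1 : ℝ) ≤ d) hγ1
  set ρ : ℝ := S / (κ * d) with hρ
  have hρ0 : 0 < ρ := by positivity
  have hρκ : κ * d * ρ = S := by rw [hρ]; field_simp
  -- `ρ ^ 2 ≤ d ^ γ / d ^ 2 ≤ 1 / d ≤ 1 / 3 < 4 / 9`, by `d ≥ 3`. The threshold `2 / 3` is where `ρ
  -- ≤ 2 (1 - ρ)`, and `1 - ρ ≤ log (1 / ρ)`.
  have hρ1 : ρ ≤ 2 / 3 := by
    have h1 : (κ * d) ^ 2 * ρ ^ 2 ≤ (κ * d) ^ 2 * (4 / 9) := by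
      rw [← mul_pow, hρκ]
      refine hSκ.trans ?_
      rw [mul_pow, mul_assoc]
      gcongr
      nlinarith
    have h2 : ρ ^ 2 ≤ (2 / 3) ^ 2 := by
      have := le_of_mul_le_mul_left h1 (by positivity)
      linarith
    exact le_of_sq_le_sq h2 (by norm_num)
  have hlog : Real.log (κ * d / S) = -Real.log ρ := by
    rw [← Real.log_inv, hρ, inv_div]
  have hlog1 : 1 - ρ ≤ Real.log (κ * d / S) := by
    rw [hlog]
    linarith [Real.log_le_sub_one_of_pos hρ0]
  -- The rate `λγ / (2d)` times the factor `4d / (λγ)` in `δ` is `2`, the exponent of `ρ`.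
  have hrate : ((1 - lam / d) ^ (γ / 2)) ^ δ ≤ ρ ^ 2 := by
    refine (rate_pow_le (by omega) hlam1 hγ0 δ).trans ?_
    rw [← Real.exp_log (pow_pos hρ0 2), Real.log_pow]
    refine Real.exp_le_exp.2 ?_
    have h1 := mul_le_mul_of_nonneg_left hδ (show 0 ≤ lam * γ / (2 * d) by positivity)
    have h2 : lam * γ / (2 * d) * (4 * (lam * γ)⁻¹ * d * Real.log (κ * d / S)) =
        2 * Real.log (κ * d / S) := by
      field_simp
      norm_num
    rw [h2, hlog] at h1
    push_cast
    linarith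
  have hgap := one_sub_rate_ge (d := d) (by omega) hlam0 hlam1 hγ0 hγ1
  have hgap0 : 0 < lam * γ / (2 * d) := by positivity
  have hs : 0 ≤ 1 - lam / d := by
    rw [sub_nonneg, div_le_one hd0]
    linarith
  have hlg : 0 < lam * γ := by positivity
  calc κ * (d : ℝ) ^ γ * ((1 - lam / d) ^ (γ / 2)) ^ δ / (1 - (1 - lam / d) ^ (γ / 2))
      ≤ κ * d * ρ ^ 2 / (lam * γ / (2 * d)) := by gcongr
    _ = S * (ρ * (2 * (lam * γ)⁻¹ * d)) := by
        rw [pow_two, ← mul_assoc, hρκ]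
        field_simp
    _ ≤ S * (4 * (lam * γ)⁻¹ * d * Real.log (κ * d / S)) := by
        have h1 : 0 < (lam * γ)⁻¹ * d := by positivity
        refine mul_le_mul_of_nonneg_left ?_ hS.le
        nlinarith
    _ ≤ S * δ := by gcongr

end Constants

/-! ### Bias and mean squared error of the estimator -/

lemma burnInEstimator_sub {d : ℕ} (V : Matrix (Fin d) (Fin d) ℝ) (h : Eucl d → ℝ) {k : ℕ}
    (hk : 0 < k) (i : ℕ → Fin d) (g : ℕ → ℝ) (c : ℝ) :
    burnInEstimator V h (2 * k) i g - c =
      (∑ j ∈ Finset.Ico k (2 * k), (h (chain V i g j) - c)) / k := by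
  have hk2 : 2 * k - k = k := by omega
  have hk0 : (k : ℝ) ≠ 0 := by positivity
  rw [burnInEstimator, Nat.mul_div_cancel_left k two_pos, Finset.sum_sub_distrib,
    Finset.sum_const, Nat.card_Ico, hk2]
  push_cast
  rw [nsmul_eq_mul]
  field_simp

theorem mainTheorem4 {d : ℕ} (hd : 3 ≤ d)
    (V : Matrix (Fin d) (Fin d) ℝ) (hV : V.PosDef) (hVdiag : ∀ a, V a a = 1)
    (lam : ℝ) (hlam : IsLeast {μ : ℝ | Module.End.HasEigenvalue (Matrix.toLin' V) μ} lam)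
    (κ γ : ℝ) (hκ : 0 < κ) (hγ0 : 0 < γ) (hγ1 : γ ≤ 1)
    (h : EuclideanSpace ℝ (Fin d) → ℝ) (hh : IsGaussianLipschitz κ γ V h)
    (κ' : ℝ) (hκ' : κ' = 2 * κ * (d : ℝ) ^ (1 + γ) / (lam * γ))
    (δ : ℤ) (hδ : δ = ⌈4 * (lam * γ)⁻¹ * d * Real.log (κ * d / gaussianStd V h)⌉)
    {Ω : Type*} [MeasurableSpace Ω] (P : Measure Ω) [IsProbabilityMeasure P]
    (i : ℕ → Ω → Fin d) (g : ℕ → Ω → ℝ) (hig : IsChainInput P i g)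
    (n : ℕ) (hn0 : 0 < n) (hn : Even n) :
    MemLp h 2 (multivariateGaussian 0 V) ∧
    MemLp (fun ω => burnInEstimator V h n (fun k => i k ω) (fun k => g k ω)) 2 P ∧
    |∫ ω, (burnInEstimator V h n (fun k => i k ω) (fun k => g k ω) - gaussianMean V h) ∂P|
      ≤ 2 * κ' * (Real.exp (-(lam * γ * n / (4 * d))) / n) ∧
    (0 < gaussianStd V h → 2 * δ < (n : ℤ) →
      ∫ ω, (burnInEstimator V h n (fun k => i k ω) (fun k => g k ω) - gaussianMean V h) ^ 2 ∂P
        ≤ 34 * (δ * gaussianStd V h ^ 2 / n)) := by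
  obtain ⟨k, rfl⟩ := hn.two_dvd
  have hk : 0 < k := by omega
  have hk0 : (0 : ℝ) < k := by exact_mod_cast hk
  have hd0 : 0 < d := by omega
  have hdr : (0 : ℝ) < d := by exact_mod_cast hd0
  have hd1 : (1 : ℝ) ≤ d := by exact_mod_cast hd0
  have hi : IsUniformIndices P i := ⟨hig.measurable_index, hig.law_index, hig.iIndepFun_index⟩
  have hg : IsStdNoise P g := ⟨hig.measurable_noise, hig.law_noise, hig.iIndepFun_noise⟩
  have hind := hig.indepFun
  have hV' := hV.posSemidef
  have hhm := hh.measurable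
  have hlam0 := leastEigenvalue_pos hV hlam
  have hlam1 := leastEigenvalue_le_one hV hVdiag hlam ⟨0, hd0⟩
  have hs : 0 ≤ 1 - lam / d := by
    rw [sub_nonneg, div_le_one hdr]
    linarith
  set r : ℝ := (1 - lam / d) ^ (γ / 2) with hr
  set K : ℝ := κ * (d : ℝ) ^ γ with hK
  have hr0 : 0 ≤ r := by positivity
  have hgap : lam * γ / (2 * d) ≤ 1 - r := one_sub_rate_ge hd0 hlam0 hlam1 hγ0 hγ1
  have hgap0 : 0 < lam * γ / (2 * d) := by positivity
  have hr1 : r < 1 := by linarith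
  have hK0 : 0 ≤ K := by positivity
  set μ := (multivariateGaussian 0 V).prod P with hμ
  let A (j : ℕ) (p : Eucl d × Ω) : ℝ :=
    h (chain V (fun k => i k p.2) (fun k => g k p.2) j) - gaussianMean V h
  let B (j : ℕ) (p : Eucl d × Ω) : ℝ := h (stationaryChain V i g j p) - gaussianMean V h
  have hchain (j : ℕ) : Measurable fun ω => chain V (fun k => i k ω) (fun k => g k ω) j :=
    (measurable_chain V j).comp ((measurable_pi_lambda _ hi.measurable).prodMk
      (measurable_pi_lambda _ hg.measurable))
  -- The given chain is the chain restarted at time `0`, so the coupling bounds apply with `j = 0`.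
  have hrestart (j : ℕ) (p : Eucl d × Ω) : restartedChain V i g 0 j p =
      chain V (fun k => i k p.2) (fun k => g k p.2) j := by
    simp only [restartedChain, zero_add]
  have hB (j : ℕ) : MemLp (B j) 2 μ :=
    (hh.memLp_stationaryChain hi hg hind hV' hVdiag j).sub (memLp_const _)
  have hdiff (j : ℕ) : MemLp (fun p => B j p - A j p) 2 μ := by
    have := memLp_coupling hd0 hi hg hind hV hVdiag hlam hγ0 hγ1 hh 0 j
    simpa only [zero_add, hrestart, A, B, sub_sub_sub_cancel_right] using this
  have hA (j : ℕ) : MemLp (A j) 2 μ := by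
    refine ((hB j).sub (hdiff j)).congr_norm ?_ (.of_forall fun p => by simp)
    exact ((hhm.comp ((hchain j).comp measurable_snd)).sub_const _).aestronglyMeasurable
  have hAB (j : ℕ) : ∫ p, (A j p - B j p) ^ 2 ∂μ ≤ (K * r ^ j) ^ 2 := by
    have := integral_coupling_sq_le hd0 hi hg hind hV hVdiag hlam hγ0 hγ1 hh 0 j
    refine le_of_eq_of_le ?_ this
    refine integral_congr_ae (.of_forall fun p => ?_)
    simp only [zero_add, hrestart, A, B]
    ring
  have hB0 (j : ℕ) : ∫ p, B j p ∂μ = 0 := by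
    rw [integral_stationaryChain hi hg hind hV' hVdiag (f := fun x => h x - gaussianMean V h)
      (by fun_prop), integral_sub ((hh.memLp hV' hVdiag).integrable (by simp)) (integrable_const _)]
    simp [gaussianMean]
  -- The stationary copy needs the enlarged space `ℝ^d × Ω`; expectations over `Ω` are lifted there.
  have hsnd (F : Ω → ℝ) : ∫ p, F p.2 ∂μ = ∫ ω, F ω ∂P := by
    rw [hμ, integral_fun_snd]
    simp
  refine ⟨hh.memLp hV' hVdiag, ?_, ?_, fun hS hδn => ?_⟩
  · have hX (j : ℕ) : MemLp (fun ω => h (chain V (fun k => i k ω) (fun k => g k ω) j)) 2 P := by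
      have h1 : MemLp (fun ω => h (chain V (fun k => i k ω) (fun k => g k ω) j) -
          gaussianMean V h) 2 P := by
        have h2 : P = μ.map Prod.snd := by rw [hμ, Measure.map_snd_prod]; simp
        rw [h2, memLp_map_measure_iff
          ((hhm.fun_comp (hchain j)).sub_const _).aestronglyMeasurable measurable_snd.aemeasurable]
        exact hA j
      exact (h1.add (memLp_const (gaussianMean V h))).congr_norm
        (hhm.comp (hchain j)).aestronglyMeasurable (.of_forall fun ω => by simp)
    have := (memLp_finsetSum (Finset.Ico (2 * k / 2) (2 * k)) fun j _ => hX j).const_mul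
      (((2 * k : ℕ) : ℝ) / 2)⁻¹
    simpa only [burnInEstimator, div_eq_inv_mul] using this
  · simp only [burnInEstimator_sub V h hk]
    rw [← hsnd fun ω => (∑ j ∈ Finset.Ico k (2 * k),
      (h (chain V (fun k => i k ω) (fun k => g k ω) j) - gaussianMean V h)) / (k : ℝ)]
    refine (abs_integral_average_le hA hB hK0 hr0 hr1 hAB hB0 k (2 * k)).trans ?_
    have hrk : r ^ k ≤ Real.exp (-(lam * γ / (2 * d) * k)) := rate_pow_le hd0 hlam1 hγ0 k
    calc K * r ^ k / (1 - r) / k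
        ≤ K * Real.exp (-(lam * γ / (2 * d) * k)) / (lam * γ / (2 * d)) / k := by gcongr
      _ = 2 * κ' * (Real.exp (-(lam * γ * (2 * k : ℕ) / (4 * d))) / (2 * k : ℕ)) := by
        have he : lam * γ * (2 * k : ℕ) / (4 * d) = lam * γ / (2 * d) * k := by
          push_cast
          field_simp
          norm_num
        rw [he, hκ', hK, Real.rpow_add hdr, Real.rpow_one]
        push_cast
        field_simp
  · have hSκ := hh.gaussianStd_sq_le hV' hVdiag
    -- The logarithm is nonnegative because `Σ² ≤ κ² d ^ γ ≤ (κ d)²`; thus `δ` is a natural number.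
    have hδ0 : 0 ≤ δ := by
      rw [hδ]
      refine Int.ceil_nonneg (mul_nonneg (by positivity) (Real.log_nonneg ?_))
      rw [le_div_iff₀ hS, one_mul]
      refine le_of_sq_le_sq (hSκ.trans ?_) (by positivity)
      rw [mul_pow]
      gcongr
      calc (d : ℝ) ^ γ ≤ (d : ℝ) ^ (2 : ℝ) :=
            Real.rpow_le_rpow_of_exponent_le hd1 (by linarith)
        _ = (d : ℝ) ^ 2 := by norm_cast
    lift δ to ℕ using hδ0
    have hδ' : 4 * (lam * γ)⁻¹ * d * Real.log (κ * d / gaussianStd V h) ≤ δ := by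
      have := Int.le_ceil (4 * (lam * γ)⁻¹ * d * Real.log (κ * d / gaussianStd V h))
      rw [← hδ] at this
      exact_mod_cast this
    have hmix := mixing_time_bound hd hlam0 hlam1 hγ0 hγ1 hκ hS hSκ hδ'
    simp only [burnInEstimator_sub V h hk]
    rw [← hsnd fun ω => ((∑ j ∈ Finset.Ico k (2 * k),
      (h (chain V (fun k => i k ω) (fun k => g k ω) j) - gaussianMean V h)) / (k : ℝ)) ^ 2]
    refine (integral_sq_average_le hA hB hK0 hS.le hr0 hr1 hAB
      (fun j => (integral_sq_centered hi hg hind hV' hVdiag hhm j).le)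
      (abs_integral_mul_centered_le hd0 hi hg hind hV hVdiag hlam hκ hγ0 hγ1 hh) hmix
      (k := k) (by omega)).trans ?_
    have hnn : 0 ≤ (δ : ℝ) * gaussianStd V h ^ 2 / k := by positivity
    -- The argument yields the constant `10` over `k = n / 2`, that is `20` over `n`, better than
    -- the claimed `34`.
    calc 10 * ((δ : ℝ) * gaussianStd V h ^ 2 / k) ≤ 17 * ((δ : ℝ) * gaussianStd V h ^ 2 / k) := by
          linarith
      _ = 34 * (((δ : ℤ) : ℝ) * gaussianStd V h ^ 2 / (2 * k : ℕ)) := by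
          push_cast
          ring
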